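/- Let $n\in\mathbb N_0$. A function $a\in C^\infty(\mathbb R^n\times\mathbb R^n)$ belongs to $S^d_{1,0}$, $d\in\mathbb R$, if for all multi-indices $\alpha,\beta$ there is a constant $C_{\alpha\beta}$ with $$|D^\alpha_\xi D^\beta_x a(x,\xi)|\le C_{\alpha\beta}(1+|\xi|)^{d-|\alpha|}\qquad (x,\xi\in\mathbb R^n),$$ and $S^\infty_{1,0}=\bigcup_{d\in\mathbb R}S^d_{1,0}$. For $a\in S^\infty_{1,0}$ let $a(x,D)\colon\mathcal S'(\mathbb R^n)\to\mathcal S'(\mathbb R^n)$ denote the (unique) continuous linear extension of $$\mathrm{OP}(a)\varphi(x)=(2\pi)^{-n}\int e^{i x\cdot\xi}a(x,\xi)\hat\varphi(\xi)\,d\xi,\qquad \varphi\in\mathcal S(\mathbb R^n),$$ where $\hat\varphi(\xi)=\mathcal F\varphi(\xi)=\int e^{-i x\cdot\xi}\varphi(x)\,dx$ and $\mathrm{OP}(a)$ maps $\mathcal S(\mathbb R^n)$ into itself. Let $\Psi\in C^\infty(\mathbb R,\mathbb R)$ satisfy $\Psi(t)=1$ for $t\le\frac{11}{10}$ and $\Psi(t)=0$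 for $t\ge\frac{13}{10}$. Put $\Psi_j(\xi)=\Psi(2^{-j}|\xi|)$ for $j\ge0$, $\Psi_j\equiv0$ for $j<0$, $\Phi_j=\Psi_j-\Psi_{j-1}$ and $\tilde\Phi_k=\Phi_{k-1}+\Phi_k+\Phi_{k+1}$. For $u\in\mathcal S'(\mathbb R^n)$ and $a\in S^\infty_{1,0}$ set $u_k=\mathcal F^{-1}(\Phi_k\hat u)$ and $$a_{j,k}(x,\eta)=\mathcal F^{-1}_{\xi\to x}\bigl(\Phi_j(\xi)\,\hat a(\xi,\eta)\bigr)\,\tilde\Phi_k(\eta),\qquad \hat a(\xi,\eta)=\mathcal F_{x\to\xi}a(x,\eta).$$ **Lemma.** For every such $\Psi$, every $a\in S^\infty_{1,0}(\mathbb R^n\times\mathbb R^n)$ and every $u\in\mathcal S'(\mathbb R^n)$, the operators $a(x,D)$ and $a_{j,k}(x,D)$ are well defined $\mathcal S'(\mathbb R^n)\to\mathcal S'(\mathbb R^n)$ as above, the three series $$a^{(1)}(x,D)u=\sum_{k=2}^\infty\sum_{j=0}^{k-2}a_{j,k}(x,D)u_k,$$ $$a^{(2)}(x,D)u=\sum_{k=0}^\infty\bigl(a_{k,k}(x,D)u_k+a_{k-1,k}(x,D)u_k+a_{k,k-1}(x,D)u_{k-1}\bigr),$$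 $$a^{(3)}(x,D)u=\sum_{j=2}^\infty\sum_{k=0}^{j-2}a_{j,k}(x,D)u_k$$ converge in $\mathcal S'(\mathbb R^n)$ (as limits of the partial sums over the outer index), and $$a^{(1)}(x,D)u+a^{(2)}(x,D)u+a^{(3)}(x,D)u=a(x,D)u.$$ -/

import Mathlib

open MeasureTheory Filter Topology FourierTransform SchwartzMap

/-- The Euclidean space `ℝⁿ`. -/
abbrev Euc (n : ℕ) : Type := EuclideanSpace ℝ (Fin n)

noncomputable section

/-! ### Symbols and pseudo-differential operators -/

/-- The Hörmander class `S^d_{ρ,δ}(ℝⁿ × ℝⁿ)`: `a` is smooth in `(x, ξ)`, and every mixed derivative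
of order `l` in `ξ` and `m` in `x` is `O((1 + |ξ|)^(d - ρ l + δ m))`, uniformly in `(x, ξ)`.
The operator norm of the multilinear derivative bounds all the derivatives `D_ξ^α D_x^β a` with
`|α| = l`, `|β| = m`, and conversely it is bounded by finitely many of them. -/
def IsSymbol {n : ℕ} (ρ δ d : ℝ) (a : Euc n → Euc n → ℂ) : Prop :=
  ContDiff ℝ (⊤ : ℕ∞) (fun p : Euc n × Euc n => a p.1 p.2) ∧
    ∀ l m : ℕ, ∃ C : ℝ, ∀ x ξ : Euc n,
      ‖iteratedFDeriv ℝ m (fun y => iteratedFDeriv ℝ l (a y) ξ) x‖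
        ≤ C * (1 + ‖ξ‖) ^ (d - ρ * l + δ * m)

/-- `S^∞_{1,0} = ⋃_d S^d_{1,0}`. -/
def IsSymbolOneZero {n : ℕ} (a : Euc n → Euc n → ℂ) : Prop :=
  ∃ d : ℝ, IsSymbol 1 0 d a

/-- `OP(a)φ(x) = (2π)⁻ⁿ ∫ e^{i x·ξ} a(x, ξ) φ̂(ξ) dξ` for a Schwartz function `φ`, where
`φ̂(ξ) = ∫ e^{-i y·ξ} φ(y) dy`. As `𝓕 φ ζ = ∫ e^{-2π i y·ζ} φ(y) dy`, one has
`φ̂(ξ) = 𝓕 φ ((2π)⁻¹ ξ)`. -/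
def opSchwartz {n : ℕ} (a : Euc n → Euc n → ℂ) (φ : 𝓢(Euc n, ℂ)) (x : Euc n) : ℂ :=
  ((2 * Real.pi) ^ n : ℂ)⁻¹ *
    ∫ ξ : Euc n, Complex.exp (Complex.I * (inner ℝ x ξ : ℝ)) * a x ξ *
      𝓕 φ ((2 * Real.pi)⁻¹ • ξ)

/-- `A` is a continuous linear operator on `𝓢'` which extends `OP(a) : 𝓢 → 𝓢`. -/
def IsOpExtension {n : ℕ} (a : Euc n → Euc n → ℂ)
    (A : 𝓢'(Euc n, ℂ) →L[ℂ] 𝓢'(Euc n, ℂ)) : Prop :=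
  ∀ φ : 𝓢(Euc n, ℂ), ∃ f : 𝓢(Euc n, ℂ), (∀ x, f x = opSchwartz a φ x) ∧
    A (φ : 𝓢'(Euc n, ℂ)) = (f : 𝓢'(Euc n, ℂ))

open Classical in
/-- `a(x,D) : 𝓢' → 𝓢'`, the continuous extension of `OP(a) : 𝓢 → 𝓢` (unique by
`IsOpExtension.unique`; by convention `0` if there is none). -/
def pseudoDiff {n : ℕ} (a : Euc n → Euc n → ℂ) : 𝓢'(Euc n, ℂ) →L[ℂ] 𝓢'(Euc n, ℂ) :=
  if h : ∃ A, IsOpExtension a A then h.choose else 0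

/-! ### Littlewood-Paley decomposition -/

/-- The cut-off functions `Ψ` on which the Littlewood-Paley decomposition is built. -/
structure IsLPCutoff (Ψ : ℝ → ℝ) : Prop where
  smooth : ContDiff ℝ (⊤ : ℕ∞) Ψ
  eq_one : ∀ t, t ≤ 11 / 10 → Ψ t = 1
  eq_zero : ∀ t, 13 / 10 ≤ t → Ψ t = 0

/-- `Ψ_j(ξ) = Ψ(2^{-j} |ξ|)` for `j ≥ 0`, and `Ψ_j = 0` for `j < 0`. -/
def lpPsi {n : ℕ} (Ψ : ℝ → ℝ) (j : ℤ) (ξ : Euc n) : ℂ :=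
  if 0 ≤ j then (Ψ ((2 : ℝ) ^ (-j) * ‖ξ‖) : ℂ) else 0

/-- `Φ_j = Ψ_j - Ψ_{j-1}`; in particular `Φ_0 = Ψ_0`, and `Φ_j = 0` for `j < 0`. -/
def lpPhi {n : ℕ} (Ψ : ℝ → ℝ) (j : ℤ) (ξ : Euc n) : ℂ :=
  lpPsi Ψ j ξ - lpPsi Ψ (j - 1) ξ

/-- `Φ̃_k = Φ_{k-1} + Φ_k + Φ_{k+1}`. -/
def lpPhiTilde {n : ℕ} (Ψ : ℝ → ℝ) (k : ℤ) (ξ : Euc n) : ℂ :=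
  lpPhi Ψ (k - 1) ξ + lpPhi Ψ k ξ + lpPhi Ψ (k + 1) ξ

/-- `Φ_j` in the frequency variable `ζ = ξ / 2π` of Mathlib's Fourier transform `𝓕`. -/
def lpMultiplier (n : ℕ) (Ψ : ℝ → ℝ) (j : ℤ) (ζ : Euc n) : ℂ :=
  lpPhi Ψ j ((2 * Real.pi) • ζ)

/-- `u_k = Φ_k(D) u` for `u ∈ 𝓢'`. -/
def lpBlock {n : ℕ} (Ψ : ℝ → ℝ) (k : ℤ) (u : 𝓢'(Euc n, ℂ)) : 𝓢'(Euc n, ℂ) :=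
  TemperedDistribution.fourierMultiplierCLM ℂ (lpMultiplier n Ψ k) u

/-- The Fourier multiplier `m(D)` with `m ∈ 𝓢` on a bounded continuous function `f`, that is
`𝓕⁻(m 𝓕 f) = (𝓕⁻ m) * f` as a function; see `fourierMultiplier_eq_multiplierConv`. -/
def multiplierConv {n : ℕ} (m : Euc n → ℂ) (f : Euc n → ℂ) (x : Euc n) : ℂ :=
  ∫ y : Euc n, 𝓕⁻ m y * f (x - y)

/-- `a_{j,k}(x, η) = 𝓕⁻_{ξ → x}(Φ_j â(·, η)) Φ̃_k(η)`, with `â` the partial Fourier transform of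
`a` in the first variable. -/
def symbolBlock {n : ℕ} (Ψ : ℝ → ℝ) (a : Euc n → Euc n → ℂ) (j k : ℤ) (x η : Euc n) : ℂ :=
  multiplierConv (lpMultiplier n Ψ j) (fun y => a y η) x * lpPhiTilde Ψ k η

/-- `a_{j,k}(x,D) u_k`. -/
def paraTerm {n : ℕ} (Ψ : ℝ → ℝ) (a : Euc n → Euc n → ℂ) (u : 𝓢'(Euc n, ℂ)) (j k : ℤ) :
    𝓢'(Euc n, ℂ) :=
  pseudoDiff (symbolBlock Ψ a j k) (lpBlock Ψ k u)

/-! ### The definitions are the intended ones -/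

theorem exists_eval_of_continuous {n : ℕ} (L : 𝓢'(Euc n, ℂ) →L[ℂ] ℂ) :
    ∃ g : 𝓢(Euc n, ℂ), ∀ v : 𝓢'(Euc n, ℂ), L v = v g := by
  let ev : 𝓢(Euc n, ℂ) →ₗ[ℂ] 𝓢'(Euc n, ℂ) →ₗ[ℂ] ℂ :=
    LinearMap.flip (PointwiseConvergenceCLM.coeLM ℂ 𝓢(Euc n, ℂ) ℂ)
  have hL : L.toLinearMap ∈ Submodule.span ℂ (Set.range fun g => ev g) := by
    rw [LinearMap.mem_span_iff_continuous]
    have hc : Continuous L := L.continuous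
    convert hc using 1
    rw [(PointwiseConvergenceCLM.isEmbedding_coeFn (RingHom.id ℂ) 𝓢(Euc n, ℂ) ℂ).eq_induced]
    simp only [Pi.topologicalSpace, induced_iInf, induced_compose]
    · rfl
    · rfl
  have hr : Submodule.span ℂ (Set.range fun g => ev g) = LinearMap.range ev := by
    rw [← LinearMap.coe_range, Submodule.span_eq]
  rw [hr] at hL
  obtain ⟨g, hg⟩ := hL
  exact ⟨g, fun v => (LinearMap.congr_fun hg v).symm⟩

theorem eq_zero_of_integral_mul {n : ℕ} (g : 𝓢(Euc n, ℂ))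
    (hint : ∀ φ : 𝓢(Euc n, ℂ), ∫ x, g x * φ x = 0) : g = 0 := by
  have hae : ∀ᵐ x, g x = 0 := by
    refine ae_eq_zero_of_integral_contDiff_smul_eq_zero (μ := volume)
      (g.continuous.locallyIntegrable) ?_
    intro χ hχ hχc
    have hs : ContDiff ℝ (⊤ : ℕ∞) (fun x => (χ x : ℂ)) :=
      Complex.ofRealCLM.contDiff.comp hχ
    have hc : HasCompactSupport (fun x => (χ x : ℂ)) :=
      HasCompactSupport.comp_left (g := fun r : ℝ => (r : ℂ)) hχc Complex.ofReal_zero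
    have h := hint (hc.toSchwartzMap hs)
    rw [← h]
    refine integral_congr_ae (Eventually.of_forall fun x => ?_)
    simp [mul_comm]
  ext x
  have := (Continuous.ae_eq_iff_eq volume g.continuous continuous_const).1 hae
  simpa using congrFun this x

/-- A continuous operator on `𝓢'` that extends `OP(a)` is unique. -/
theorem IsOpExtension.unique {n : ℕ} {a : Euc n → Euc n → ℂ}
    {A B : 𝓢'(Euc n, ℂ) →L[ℂ] 𝓢'(Euc n, ℂ)} (hA : IsOpExtension a A) (hB : IsOpExtension a B) :
    A = B := by
  have h0 : ∀ φ : 𝓢(Euc n, ℂ), A (φ : 𝓢'(Euc n, ℂ)) = B (φ : 𝓢'(Euc n, ℂ)) := by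
    intro φ
    obtain ⟨f, hf, hf'⟩ := hA φ
    obtain ⟨g, hg, hg'⟩ := hB φ
    have : f = g := by ext x; rw [hf, hg]
    rw [hf', hg', this]
  refine ContinuousLinearMap.ext fun u => ContinuousLinearMap.ext fun ψ => ?_
  obtain ⟨g, hg⟩ := exists_eval_of_continuous
    ((PointwiseConvergenceCLM.evalCLM (RingHom.id ℂ) ℂ ψ).comp A)
  obtain ⟨g', hg'⟩ := exists_eval_of_continuous
    ((PointwiseConvergenceCLM.evalCLM (RingHom.id ℂ) ℂ ψ).comp B)
  have h1 : ∀ v : 𝓢'(Euc n, ℂ), A v ψ = v g := hg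
  have h2 : ∀ v : 𝓢'(Euc n, ℂ), B v ψ = v g' := hg'
  have hgg : g - g' = 0 := by
    refine eq_zero_of_integral_mul _ fun φ => ?_
    have h3 : (φ : 𝓢'(Euc n, ℂ)) (g - g') = 0 := by
      rw [map_sub, ← h1, ← h2, h0, sub_self]
    rw [SchwartzMap.coe_apply] at h3
    exact h3
  have h4 : g = g' := sub_eq_zero.1 hgg
  exact (h1 u).trans ((congrArg (fun h => u h) h4).trans (h2 u).symm)

/-- `multiplierConv m f` is the function that represents the tempered distribution
`m(D) f = 𝓕⁻(m 𝓕 f)`. -/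
theorem fourierMultiplier_eq_multiplierConv {n : ℕ} (m : 𝓢(Euc n, ℂ)) {f : Euc n → ℂ}
    (hf : f.HasTemperateGrowth) {C : ℝ} (hC : ∀ x, ‖f x‖ ≤ C) (ψ : 𝓢(Euc n, ℂ)) :
    TemperedDistribution.fourierMultiplierCLM ℂ m (hf.toTemperedDistribution volume) ψ
      = ∫ x, ψ x * multiplierConv m f x := by
  have hker : ∀ y, 𝓕 (SchwartzMap.smulLeftCLM ℂ m (𝓕⁻ ψ)) y
      = ∫ x, 𝓕⁻ (m : Euc n → ℂ) (x - y) * ψ x := by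
    intro y
    have hfl := VectorFourier.integral_fourierIntegral_smul_eq_flip (e := Real.fourierChar)
      (μ := volume) (ν := volume) (L := -innerₗ (Euc n)) (f := (ψ : Euc n → ℂ))
      (g := fun ζ => Real.fourierChar (-inner ℝ ζ y) • m ζ) Real.continuous_fourierChar
      (by simp only [LinearMap.neg_apply, innerₗ_apply_apply]; fun_prop)
      ψ.integrable
      ((Real.fourierIntegral_convergent_iff y).2 m.integrable)
    have hl : 𝓕 (SchwartzMap.smulLeftCLM ℂ m (𝓕⁻ ψ)) y
        = ∫ ζ, VectorFourier.fourierIntegral Real.fourierChar volume (-innerₗ (Euc n)) ψ ζ •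
            (Real.fourierChar (-inner ℝ ζ y) • m ζ) := by
      rw [SchwartzMap.fourier_coe, Real.fourier_eq]
      refine integral_congr_ae (Eventually.of_forall fun ζ => ?_)
      have : 𝓕⁻ ψ ζ = VectorFourier.fourierIntegral Real.fourierChar volume
          (-innerₗ (Euc n)) ψ ζ := by
        rw [SchwartzMap.fourierInv_coe]; rfl
      simp only [SchwartzMap.smulLeftCLM_apply_apply m.hasTemperateGrowth, Circle.smul_def,
        smul_eq_mul, this]
      ring
    rw [hl, hfl]
    refine integral_congr_ae (Eventually.of_forall fun x => ?_)
    have hshift : VectorFourier.fourierIntegral Real.fourierChar volume (-innerₗ (Euc n)).flip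
        (fun ζ => Real.fourierChar (-inner ℝ ζ y) • m ζ) x
        = 𝓕⁻ (m : Euc n → ℂ) (x - y) := by
      rw [Real.fourierInv_eq, VectorFourier.fourierIntegral]
      refine integral_congr_ae (Eventually.of_forall fun ζ => ?_)
      simp only [LinearMap.flip_apply, LinearMap.neg_apply, innerₗ_apply_apply, neg_neg,
        inner_sub_right, Circle.smul_def, smul_eq_mul]
      rw [sub_eq_add_neg, AddChar.map_add_eq_mul, Circle.coe_mul, real_inner_comm, mul_assoc]
    simp only [hshift, smul_eq_mul]
    ring
  have hlhs : TemperedDistribution.fourierMultiplierCLM ℂ m (hf.toTemperedDistribution volume) ψ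
      = ∫ y, 𝓕 (SchwartzMap.smulLeftCLM ℂ m (𝓕⁻ ψ)) y • f y := rfl
  rw [hlhs]
  simp_rw [hker]
  have hK : Integrable (𝓕⁻ (m : Euc n → ℂ)) := by
    rw [← SchwartzMap.fourierInv_coe]; exact (𝓕⁻ m).integrable
  have hint : Integrable (Function.uncurry fun y x : Euc n =>
      𝓕⁻ (m : Euc n → ℂ) (x - y) * ψ x * f y) (volume.prod volume) := by
    have h1 := (ψ.integrable (μ := volume)).convolution_integrand (ContinuousLinearMap.mul ℂ ℂ)
      (hK.comp_neg)
    have h2 : Integrable (fun p : Euc n × Euc n =>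
        f p.1 * (ψ p.2 * 𝓕⁻ (m : Euc n → ℂ) (-(p.1 - p.2)))) (volume.prod volume) :=
      h1.bdd_mul (c := C)
        ((hf.1.continuous.comp continuous_fst).aestronglyMeasurable)
        (Eventually.of_forall fun p => hC p.1)
    refine h2.congr (Eventually.of_forall fun p => ?_)
    simp only [Function.uncurry, neg_sub]
    ring
  calc ∫ y, (∫ x, 𝓕⁻ (m : Euc n → ℂ) (x - y) * ψ x) • f y
      = ∫ y, ∫ x, 𝓕⁻ (m : Euc n → ℂ) (x - y) * ψ x * f y := by
        simp_rw [smul_eq_mul, integral_mul_const]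
    _ = ∫ x, ∫ y, 𝓕⁻ (m : Euc n → ℂ) (x - y) * ψ x * f y := integral_integral_swap hint
    _ = ∫ x, ψ x * multiplierConv m f x := by
        congr 1
        ext x
        rw [multiplierConv, ← integral_const_mul,
          ← integral_sub_left_eq_self (fun y => ψ x * (𝓕⁻ (m : Euc n → ℂ) y * f (x - y))) volume x]
        congr 1
        ext y
        rw [sub_sub_cancel]
        ring

end

-- Write `B_{j,k}` and `T_{j,k}` for the distributions `lowPassBlock` and `lowPassTrunc`: the
-- operator with symbol `Ψ_j(D_x)a`, applied to `Φ_k(D)u` and to `Ψ_k(D)u` respectively. Since `Φ̃_k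
-- = 1` on the support of `Φ_k`, each term `a_{j,k}(x,D)u_k` equals `B_{j,k} - B_{j-1,k}`
-- (`paraTerm_eq`), and `B_{j,k} = T_{j,k} - T_{j,k-1}` (`lowPassBlock_eq`). All finite sums then
-- telescope: up to outer index `N`, the three partial sums add up to `T_{N,N}` (`sum_paraTerm_eq`).
--
-- Two limits remain. The first series reduces to `∑ B_{k-2,k}`, and the terms of the second are
-- combinations of four `B`s with second index `k` or `k - 1`. Both converge because `B_{j,k}` is
-- `O(2^{-k})` uniformly in `j` (`exists_norm_lowPassBlock_le`). Moreover `T_{N,N}` tends to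
-- `a(x,D)u` (`tendsto_lowPassTrunc`). The third series converges as the remainder and needs no
-- estimate of its own.
--
-- Both limits come from one continuity estimate, `exists_norm_pseudoDiff_apply_le`: for fixed `u`
-- and `d`, `|a(x,D)u(ψ)|` is at most `R` times a Schwartz seminorm of `ψ`, where `R` bounds
-- finitely many derivatives of `a` relative to `(1 + |ξ|)^d`. Raising the order by one makes `Φ_k`
-- and `Ψ_k - 1` small of size `2^{-k}`, because they vanish near low frequencies; `Ψ_j(D_x)a - a`
-- is `O(2^{-j})` because `Ψ_j(D_x)` averages over distances `2^{-j}`.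
--
-- The estimate and the existence of `a(x,D)` on `𝓢'` follow by duality. The transpose of `OP(a)` is
-- `𝓕⁻` after `ψ ↦ ∫ e^{-2πi x·ζ} a(x, -2πζ) ψ(x) dx`, and integration by parts in `x` shows that
-- this map is continuous on `𝓢`. Only growth bounds on the derivatives of `a` are used, which is
-- why the proof works with `IsAmplitude`.

universe u

/-! ### Mixed partial derivatives and full derivatives -/

section Symbols

variable {V W F G : Type u} [NormedAddCommGroup V] [NormedSpace ℝ V]
  [NormedAddCommGroup W] [NormedSpace ℝ W] [NormedAddCommGroup F] [NormedSpace ℝ F]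
  [NormedAddCommGroup G] [NormedSpace ℝ G]

/-- The induction replaces `F` by `W →L[ℝ] F`, so the spaces share a universe. -/
theorem contDiff_iteratedFDeriv_snd (l : ℕ) {w : V → W → F}
    (hw : ContDiff ℝ (⊤ : ℕ∞) (fun p : V × W => w p.1 p.2)) :
    ContDiff ℝ (⊤ : ℕ∞) (fun p : V × W => iteratedFDeriv ℝ l (w p.1) p.2) := by
  induction l generalizing F with
  | zero =>
    exact (continuousMultilinearCurryFin0 ℝ W F).symm.contDiff.comp hw
  | succ l ih =>
    have h1 : ContDiff ℝ (⊤ : ℕ∞) (fun p : V × W => fderiv ℝ (w p.1) p.2) := by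
      refine ContDiff.fderiv (n := (⊤ : ℕ∞)) (f := fun p : V × W => w p.1) (g := fun p => p.2) ?_
        contDiff_snd le_rfl
      exact hw.comp (by fun_prop : ContDiff ℝ _ fun q : (V × W) × W => (q.1.1, q.2))
    have h2 := ih (w := fun y ξ => fderiv ℝ (w y) ξ) h1
    have h3 := (continuousMultilinearCurryRightEquiv' ℝ l W F).symm.contDiff.comp h2
    convert h3 using 2 with p
    rw [iteratedFDeriv_succ_eq_comp_right]
    rfl

theorem norm_iteratedFDeriv_fst_snd_succ (l m : ℕ) (w : V → W → F) (x : V) (ξ : W) :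
    ‖iteratedFDeriv ℝ m (fun y => iteratedFDeriv ℝ (l + 1) (w y) ξ) x‖
      = ‖iteratedFDeriv ℝ m (fun y => iteratedFDeriv ℝ l (fderiv ℝ (w y)) ξ) x‖ := by
  rw [← LinearIsometryEquiv.norm_iteratedFDeriv_comp_left
    (continuousMultilinearCurryRightEquiv' ℝ l W F).symm
    (fun y => iteratedFDeriv ℝ l (fderiv ℝ (w y)) ξ)]
  congr 2
  funext y
  rw [iteratedFDeriv_succ_eq_comp_right]
  rfl

theorem norm_iteratedFDeriv_fst_snd_comp_le (l m : ℕ) {w : V → W → F}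
    (hw : ContDiff ℝ (⊤ : ℕ∞) (fun p : V × W => w p.1 p.2)) (L : F →L[ℝ] G) (hL : ‖L‖ ≤ 1)
    (x : V) (ξ : W) :
    ‖iteratedFDeriv ℝ m (fun y => iteratedFDeriv ℝ l (fun η => L (w y η)) ξ) x‖
      ≤ ‖iteratedFDeriv ℝ m (fun y => iteratedFDeriv ℝ l (w y) ξ) x‖ := by
  have h1 : (fun y => iteratedFDeriv ℝ l (fun η => L (w y η)) ξ) =
      (ContinuousLinearMap.compContinuousMultilinearMapL ℝ (fun _ : Fin l => W) F G L) ∘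
        (fun y => iteratedFDeriv ℝ l (w y) ξ) := by
    funext y
    have hy : ContDiff ℝ (⊤ : ℕ∞) (w y) :=
      hw.comp (by fun_prop : ContDiff ℝ _ fun η : W => (y, η))
    exact L.iteratedFDeriv_comp_left (hy.contDiffAt (x := ξ)) (by exact_mod_cast le_top)
  have h2 : ContDiff ℝ (⊤ : ℕ∞) (fun y => iteratedFDeriv ℝ l (w y) ξ) :=
    (contDiff_iteratedFDeriv_snd l hw).comp (by fun_prop : ContDiff ℝ _ fun y : V => (y, ξ))
  rw [h1]
  refine (ContinuousLinearMap.norm_iteratedFDeriv_comp_left _ (h2.contDiffAt (x := x))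
    (by exact_mod_cast le_top)).trans ?_
  refine mul_le_of_le_one_left (norm_nonneg _) ?_
  refine ContinuousLinearMap.opNorm_le_bound _ zero_le_one fun f => ?_
  refine (L.norm_compContinuousMultilinearMap_le f).trans ?_
  gcongr

theorem contDiff_fderiv_fst {w : V → W → F}
    (hw : ContDiff ℝ (⊤ : ℕ∞) (fun p : V × W => w p.1 p.2)) :
    ContDiff ℝ (⊤ : ℕ∞) (fun p : V × W => fderiv ℝ (fun y => w y p.2) p.1) :=
  ContDiff.fderiv (n := (⊤ : ℕ∞)) (f := fun (p : V × W) y => w y p.2) (g := fun p => p.1)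
    (hw.comp (by fun_prop : ContDiff ℝ _ fun q : (V × W) × V => (q.2, q.1.2))) contDiff_fst le_rfl

theorem contDiff_fderiv_snd {w : V → W → F}
    (hw : ContDiff ℝ (⊤ : ℕ∞) (fun p : V × W => w p.1 p.2)) :
    ContDiff ℝ (⊤ : ℕ∞) (fun p : V × W => fderiv ℝ (w p.1) p.2) :=
  ContDiff.fderiv (n := (⊤ : ℕ∞)) (f := fun (p : V × W) η => w p.1 η) (g := fun p => p.2)
    (hw.comp (by fun_prop : ContDiff ℝ _ fun q : (V × W) × W => (q.1.1, q.2))) contDiff_snd le_rfl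

theorem fderiv_fst_eq {w : V → W → F}
    (hw : ContDiff ℝ (⊤ : ℕ∞) (fun p : V × W => w p.1 p.2)) (y : V) (ξ : W) :
    fderiv ℝ (fun y => w y ξ) y =
      (fderiv ℝ (fun p : V × W => w p.1 p.2) (y, ξ)).comp (ContinuousLinearMap.inl ℝ V W) := by
  have h1 : HasFDerivAt (fun p : V × W => w p.1 p.2) _ (y, ξ) :=
    (hw.differentiable (by simp)).differentiableAt.hasFDerivAt
  exact (HasFDerivAt.comp (f := fun y => (y, ξ)) y h1 (hasFDerivAt_prodMk_left y ξ)).fderiv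

theorem fderiv_snd_eq {w : V → W → F}
    (hw : ContDiff ℝ (⊤ : ℕ∞) (fun p : V × W => w p.1 p.2)) (y : V) (ξ : W) :
    fderiv ℝ (w y) ξ =
      (fderiv ℝ (fun p : V × W => w p.1 p.2) (y, ξ)).comp (ContinuousLinearMap.inr ℝ V W) := by
  have h1 : HasFDerivAt (fun p : V × W => w p.1 p.2) _ (y, ξ) :=
    (hw.differentiable (by simp)).differentiableAt.hasFDerivAt
  exact (HasFDerivAt.comp (f := fun ξ => (y, ξ)) ξ h1 (hasFDerivAt_prodMk_right y ξ)).fderiv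

/-- Schwarz's theorem: the second derivative of the joint function is symmetric, evaluated here on
the vectors `(0, v)` and `(x, 0)`. -/
theorem fderiv_snd_fderiv_fst {w : V → W → F}
    (hw : ContDiff ℝ (⊤ : ℕ∞) (fun p : V × W => w p.1 p.2)) (y : V) (ξ : W) :
    fderiv ℝ (fun η => fderiv ℝ (fun z => w z η) y) ξ =
      ContinuousLinearMap.flipₗᵢ ℝ V W F
        (fderiv ℝ (fun z => fderiv ℝ (w z) ξ) y) := by
  have hs := (hw.contDiffAt (x := (y, ξ))).isSymmSndFDerivAt
    (by simpa using WithTop.coe_le_coe.2 (le_top : (2 : ℕ∞) ≤ ⊤))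
  have hd : DifferentiableAt ℝ (fderiv ℝ (fun p : V × W => w p.1 p.2)) (y, ξ) :=
    ((hw.fderiv_right (m := (⊤ : ℕ∞)) le_rfl).differentiable (by simp)).differentiableAt
  have h1 := ((ContinuousLinearMap.compL ℝ V (V × W) F).flip
      (ContinuousLinearMap.inl ℝ V W)).hasFDerivAt.comp ξ
    (HasFDerivAt.comp (f := fun ξ => (y, ξ)) ξ hd.hasFDerivAt (hasFDerivAt_prodMk_right y ξ))
  have h2 := ((ContinuousLinearMap.compL ℝ W (V × W) F).flip
      (ContinuousLinearMap.inr ℝ V W)).hasFDerivAt.comp y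
    (HasFDerivAt.comp (f := fun y => (y, ξ)) y hd.hasFDerivAt (hasFDerivAt_prodMk_left y ξ))
  replace h1 := h1.congr_of_eventuallyEq (f₁ := fun η => fderiv ℝ (fun z => w z η) y)
    (Eventually.of_forall fun η => fderiv_fst_eq hw y η)
  replace h2 := h2.congr_of_eventuallyEq (f₁ := fun z => fderiv ℝ (w z) ξ)
    (Eventually.of_forall fun z => fderiv_snd_eq hw z ξ)
  rw [h1.fderiv, h2.fderiv]
  ext v x
  simpa using hs (0, v) (x, 0)

/-- By symmetry of second derivatives, the inner `x`-derivative moves outwards past the `l`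
derivatives in `ξ`, one at a time; each exchange composes with an isometric flip. The bounds on the
mixed derivatives of `w` are thus inherited by its `x`-derivative. -/
theorem norm_iteratedFDeriv_fst_snd_fderiv_fst_le (l m : ℕ) {w : V → W → F}
    (hw : ContDiff ℝ (⊤ : ℕ∞) (fun p : V × W => w p.1 p.2)) (x : V) (ξ : W) :
    ‖iteratedFDeriv ℝ m (fun y => iteratedFDeriv ℝ l (fun η => fderiv ℝ (fun z => w z η) y) ξ) x‖
      ≤ ‖iteratedFDeriv ℝ (m + 1) (fun y => iteratedFDeriv ℝ l (w y) ξ) x‖ := by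
  induction l generalizing F with
  | zero =>
    have h1 : (fun y => iteratedFDeriv ℝ 0 (fun η => fderiv ℝ (fun z => w z η) y) ξ) =
      (continuousMultilinearCurryFin0 ℝ W (V →L[ℝ] F)).symm ∘ (fderiv ℝ (fun z => w z ξ)) := rfl
    have h2 : (fun y => iteratedFDeriv ℝ 0 (w y) ξ) =
      (continuousMultilinearCurryFin0 ℝ W F).symm ∘ (fun z => w z ξ) := rfl
    rw [h1, h2, LinearIsometryEquiv.norm_iteratedFDeriv_comp_left,
      LinearIsometryEquiv.norm_iteratedFDeriv_comp_left, norm_iteratedFDeriv_fderiv]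
  | succ l ih =>
    rw [norm_iteratedFDeriv_fst_snd_succ l m (fun y η => fderiv ℝ (fun z => w z η) y),
      norm_iteratedFDeriv_fst_snd_succ]
    have hw2 := contDiff_fderiv_snd hw
    refine le_trans ?_ (ih (w := fun y ξ => fderiv ℝ (w y) ξ) hw2)
    have h3 : ∀ y, fderiv ℝ (fun η => fderiv ℝ (fun z => w z η) y) =
        fun η => ((ContinuousLinearMap.flipₗᵢ ℝ V W F).toLinearIsometry.toContinuousLinearMap :
          (V →L[ℝ] W →L[ℝ] F) →L[ℝ] _) (fderiv ℝ (fun z => fderiv ℝ (w z) η) y) :=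
      fun y => funext fun η => fderiv_snd_fderiv_fst hw y η
    simp_rw [h3]
    refine norm_iteratedFDeriv_fst_snd_comp_le l m
      (w := fun y η => fderiv ℝ (fun z => fderiv ℝ (w z) η) y) (contDiff_fderiv_fst hw2) _ ?_ x ξ
    exact LinearIsometry.norm_toContinuousLinearMap_le _

/-- The full first derivative is the sum of the two partial ones composed with the coordinate
projections, which have norm at most one. -/
theorem norm_iteratedFDeriv_succ_prod_le (k : ℕ) {w : V → W → F}
    (hw : ContDiff ℝ (⊤ : ℕ∞) (fun p : V × W => w p.1 p.2)) (p : V × W) :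
    ‖iteratedFDeriv ℝ (k + 1) (fun p : V × W => w p.1 p.2) p‖ ≤
      ‖iteratedFDeriv ℝ k (fun p : V × W => fderiv ℝ (fun y => w y p.2) p.1) p‖ +
      ‖iteratedFDeriv ℝ k (fun p : V × W => fderiv ℝ (w p.1) p.2) p‖ := by
  have h1 : fderiv ℝ (fun p : V × W => w p.1 p.2) =
      (((ContinuousLinearMap.compL ℝ (V × W) V F).flip (ContinuousLinearMap.fst ℝ V W)) ∘
        (fun p : V × W => fderiv ℝ (fun y => w y p.2) p.1)) +
      (((ContinuousLinearMap.compL ℝ (V × W) W F).flip (ContinuousLinearMap.snd ℝ V W)) ∘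
        (fun p : V × W => fderiv ℝ (w p.1) p.2)) := by
    funext q
    ext v <;> simp [fderiv_fst_eq hw, fderiv_snd_eq hw, ← Prod.zero_eq_mk]
  have c1 := contDiff_fderiv_fst hw
  have c2 := contDiff_fderiv_snd hw
  rw [← norm_iteratedFDeriv_fderiv, h1, iteratedFDeriv_add]
  · refine (norm_add_le _ _).trans (add_le_add ?_ ?_)
    · refine (ContinuousLinearMap.norm_iteratedFDeriv_comp_left _ (c1.contDiffAt (x := p))
        (by exact_mod_cast le_top)).trans (mul_le_of_le_one_left (norm_nonneg _) ?_)
      refine ContinuousLinearMap.opNorm_le_bound _ zero_le_one fun f => ?_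
      refine (f.opNorm_comp_le _).trans ?_
      rw [mul_comm]
      gcongr
      exact ContinuousLinearMap.norm_fst_le ..
    · refine (ContinuousLinearMap.norm_iteratedFDeriv_comp_left _ (c2.contDiffAt (x := p))
        (by exact_mod_cast le_top)).trans (mul_le_of_le_one_left (norm_nonneg _) ?_)
      refine ContinuousLinearMap.opNorm_le_bound _ zero_le_one fun f => ?_
      refine (f.opNorm_comp_le _).trans ?_
      rw [mul_comm]
      gcongr
      exact ContinuousLinearMap.norm_snd_le ..
  · exact ((ContinuousLinearMap.contDiff _).comp (c1.of_le (by exact_mod_cast le_top)))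
  · exact ((ContinuousLinearMap.contDiff _).comp (c2.of_le (by exact_mod_cast le_top)))

/-- Bounds on the mixed partial derivatives bound the full derivatives. -/
theorem exists_norm_iteratedFDeriv_prod_le {g : V × W → ℝ} (k : ℕ) {w : V → W → F}
    (hw : ContDiff ℝ (⊤ : ℕ∞) (fun p : V × W => w p.1 p.2))
    (hb : ∀ l m : ℕ, ∃ C : ℝ, ∀ x ξ,
      ‖iteratedFDeriv ℝ m (fun y => iteratedFDeriv ℝ l (w y) ξ) x‖ ≤ C * g (x, ξ)) :
    ∃ C : ℝ, ∀ p, ‖iteratedFDeriv ℝ k (fun p : V × W => w p.1 p.2) p‖ ≤ C * g p := by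
  induction k generalizing F with
  | zero =>
    obtain ⟨C, hC⟩ := hb 0 0
    refine ⟨C, fun p => ?_⟩
    simpa using hC p.1 p.2
  | succ k ih =>
    -- Both partial derivatives satisfy the hypothesis again, with `m` or `l` raised by one.
    obtain ⟨C₁, h₁⟩ := ih (w := fun x ξ => fderiv ℝ (fun y => w y ξ) x) (contDiff_fderiv_fst hw)
      (fun l m => (hb l (m + 1)).imp fun C hC x ξ =>
        (norm_iteratedFDeriv_fst_snd_fderiv_fst_le l m hw x ξ).trans (hC x ξ))
    obtain ⟨C₂, h₂⟩ := ih (w := fun x ξ => fderiv ℝ (w x) ξ) (contDiff_fderiv_snd hw)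
      (fun l m => (hb (l + 1) m).imp fun C hC x ξ =>
        (norm_iteratedFDeriv_fst_snd_succ l m w x ξ).symm.le.trans (hC x ξ))
    refine ⟨C₁ + C₂, fun p => ?_⟩
    rw [add_mul]
    exact (norm_iteratedFDeriv_succ_prod_le k hw p).trans (add_le_add (h₁ p) (h₂ p))

end Symbols

/-! ### Calculus of weighted derivative bounds -/

section DerivBound

variable {X F G H : Type u} [NormedAddCommGroup X] [NormedSpace ℝ X]
  [NormedAddCommGroup F] [NormedSpace ℝ F]
  [NormedAddCommGroup G] [NormedSpace ℝ G] [NormedAddCommGroup H] [NormedSpace ℝ H]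

/-- The derivatives of `f` up to order `K` are bounded by the weight `w`. -/
def DerivBound (K : ℕ) (w : X → ℝ) (f : X → F) : Prop :=
  ∀ k ≤ K, ∀ p, ‖iteratedFDeriv ℝ k f p‖ ≤ w p

namespace DerivBound

variable {K : ℕ} {w w₁ w₂ : X → ℝ} {f f₁ f₂ : X → F} {g : X → G}

theorem norm_le (hf : DerivBound K w f) (p : X) : ‖f p‖ ≤ w p := by
  simpa using hf 0 (Nat.zero_le _) p

theorem nonneg (hf : DerivBound K w f) (p : X) : 0 ≤ w p := (norm_nonneg _).trans (hf.norm_le p)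

theorem mono {K' : ℕ} {w' : X → ℝ} (hf : DerivBound K w f) (hK : K' ≤ K)
    (hw : ∀ p, w p ≤ w' p) : DerivBound K' w' f :=
  fun k hk p => (hf k (hk.trans hK) p).trans (hw p)

theorem fderiv (hf : DerivBound (K + 1) w f) : DerivBound K w (fderiv ℝ f) := fun k hk p => by
  rw [norm_iteratedFDeriv_fderiv]
  exact hf (k + 1) (by omega) p

theorem add (h₁ : DerivBound K w₁ f₁) (h₂ : DerivBound K w₂ f₂)
    (hf₁ : ContDiff ℝ (⊤ : ℕ∞) f₁) (hf₂ : ContDiff ℝ (⊤ : ℕ∞) f₂) :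
    DerivBound K (fun p => w₁ p + w₂ p) (fun p => f₁ p + f₂ p) := fun k hk p => by
  change ‖iteratedFDeriv ℝ k (f₁ + f₂) p‖ ≤ _
  rw [iteratedFDeriv_add (hf₁.of_le (by exact_mod_cast le_top))
    (hf₂.of_le (by exact_mod_cast le_top))]
  exact (norm_add_le _ _).trans (add_le_add (h₁ k hk p) (h₂ k hk p))

theorem clm_comp (L : F →L[ℝ] G) (hf : DerivBound K w f) (hs : ContDiff ℝ (⊤ : ℕ∞) f) :
    DerivBound K (fun p => ‖L‖ * w p) (fun p => L (f p)) := fun k hk p =>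
  (L.norm_iteratedFDeriv_comp_left hs.contDiffAt (by exact_mod_cast le_top)).trans
    (mul_le_mul_of_nonneg_left (hf k hk p) (norm_nonneg _))

theorem clm_comp_of_le_one (L : F →L[ℝ] G) (hL : ‖L‖ ≤ 1) (hf : DerivBound K w f)
    (hs : ContDiff ℝ (⊤ : ℕ∞) f) : DerivBound K w (fun p => L (f p)) :=
  (hf.clm_comp L hs).mono le_rfl fun p => mul_le_of_le_one_left (hf.nonneg p) hL

/-- Leibniz' rule; the factor `2 ^ K` is the sum of the binomial coefficients. -/
theorem bilin (B : F →L[ℝ] G →L[ℝ] H) (hB : ‖B‖ ≤ 1) (h₁ : DerivBound K w₁ f)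
    (h₂ : DerivBound K w₂ g) (hf : ContDiff ℝ (⊤ : ℕ∞) f) (hg : ContDiff ℝ (⊤ : ℕ∞) g) :
    DerivBound K (fun p => 2 ^ K * (w₁ p * w₂ p)) (fun p => B (f p) (g p)) := fun k hk p => by
  refine (B.norm_iteratedFDeriv_le_of_bilinear_of_le_one hf hg p (n := k)
    (by exact_mod_cast le_top) hB).trans ?_
  calc _ ≤ ∑ i ∈ Finset.range (k + 1), (k.choose i : ℝ) * (w₁ p * w₂ p) := by
        refine Finset.sum_le_sum fun i hi => ?_
        rw [mul_assoc]
        have hi := Finset.mem_range.1 hi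
        gcongr
        · exact h₁.nonneg p
        · exact h₁ i (by omega) p
        · exact h₂ (k - i) (by omega) p
    _ = 2 ^ k * (w₁ p * w₂ p) := by
        rw [← Finset.sum_mul]
        congr 1
        exact_mod_cast Nat.sum_range_choose k
    _ ≤ 2 ^ K * (w₁ p * w₂ p) := by
        gcongr
        · exact mul_nonneg (h₁.nonneg p) (h₂.nonneg p)
        · exact one_le_two

theorem smulRight {φ : X → G →L[ℝ] ℝ} (h₁ : DerivBound K w₁ φ) (h₂ : DerivBound K w₂ f)
    (hφ : ContDiff ℝ (⊤ : ℕ∞) φ) (hf : ContDiff ℝ (⊤ : ℕ∞) f) :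
    DerivBound K (fun p => 2 ^ K * (w₁ p * w₂ p)) (fun p => (φ p).smulRight (f p)) := by
  refine h₁.bilin (ContinuousLinearMap.smulRightL ℝ G F) ?_ h₂ hφ hf
  refine ContinuousLinearMap.opNorm_le_bound _ zero_le_one fun f => ?_
  refine ContinuousLinearMap.opNorm_le_bound _ (by positivity) fun x => ?_
  rw [one_mul]
  exact (ContinuousLinearMap.norm_smulRight_apply f x).le

theorem comp_const {f : X → G →L[ℝ] F} (L : H →L[ℝ] G) (hL : ‖L‖ ≤ 1) (hf : DerivBound K w f)
    (hs : ContDiff ℝ (⊤ : ℕ∞) f) : DerivBound K w (fun p => (f p).comp L) := by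
  refine hf.clm_comp_of_le_one ((ContinuousLinearMap.compL ℝ H G F).flip L) ?_ hs
  refine ContinuousLinearMap.opNorm_le_bound _ zero_le_one fun f => ?_
  refine (f.opNorm_comp_le _).trans ?_
  rw [mul_comm]
  gcongr

theorem clm (K : ℕ) (L : X →L[ℝ] F) : DerivBound K (fun p => max ‖L p‖ ‖L‖) L := fun k _ p => by
  rcases k with _ | _ | k
  · simp
  · simp
  · rw [← norm_iteratedFDeriv_fderiv, show _root_.fderiv ℝ L = fun _ => L from
      funext fun x => L.fderiv, iteratedFDeriv_const_of_ne (by omega)]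
    simp

/-- The chain rule gives `‖L‖ ^ k` at order `k`; `max 1 ‖L‖ ^ K` dominates these factors for all `k
≤ K`. -/
theorem comp_clm {Y : Type u} [NormedAddCommGroup Y] [NormedSpace ℝ Y] (L : Y →L[ℝ] X)
    (hf : DerivBound K w f) (hs : ContDiff ℝ (⊤ : ℕ∞) f) :
    DerivBound K (fun q => max 1 ‖L‖ ^ K * w (L q)) (fun q => f (L q)) := fun k hk q => by
  have h1 := L.iteratedFDeriv_comp_right (f := f) hs q (i := k) (by exact_mod_cast le_top)
  change ‖iteratedFDeriv ℝ k (f ∘ L) q‖ ≤ _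
  rw [h1]
  refine (ContinuousMultilinearMap.norm_compContinuousLinearMap_le _ _).trans ?_
  rw [Finset.prod_const, Finset.card_univ, Fintype.card_fin, mul_comm]
  refine mul_le_mul ?_ (hf k hk _) (norm_nonneg _) (by positivity)
  · calc ‖L‖ ^ k ≤ max 1 ‖L‖ ^ k := by gcongr; exact le_max_right _ _
      _ ≤ _ := pow_le_pow_right₀ (le_max_left _ _) hk

end DerivBound

end DerivBound

/-! ### Oscillatory integrals with a parameter-dependent amplitude -/

section Oscillatory

/-- A weight on `V × V` that decays in the first variable and grows in the second one. -/
noncomputable def oscWeight (V : Type u) [NormedAddCommGroup V] (R : ℝ) (d M : ℕ) (p : V × V) : ℝ :=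
  R * (1 + ‖p.2‖) ^ d * ((1 + ‖p.1‖) ^ M)⁻¹

theorem oscWeight_anti {V : Type u} [NormedAddCommGroup V] {R : ℝ} (hR : 0 ≤ R) (d : ℕ)
    {M M' : ℕ} (hM : M' ≤ M) (p : V × V) :
    oscWeight V R d M p ≤ oscWeight V R d M' p := by
  unfold oscWeight
  gcongr
  linarith [norm_nonneg p.1]

variable {V F : Type u} [NormedAddCommGroup V] [InnerProductSpace ℝ V]
  [NormedAddCommGroup F] [NormedSpace ℂ F]

/-- The amplitude of the derivative of the oscillatory integral. -/
noncomputable def oscDeriv (h : V × V → F) (p : V × V) : V →L[ℝ] F :=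
  (-(2 * Real.pi * Complex.I)) • ContinuousLinearMap.smulRightL ℝ V F (innerSL ℝ p.1) (h p) +
    (fderiv ℝ h p).comp (ContinuousLinearMap.inr ℝ V V)

theorem contDiff_oscDeriv {h : V × V → F} (hs : ContDiff ℝ (⊤ : ℕ∞) h) :
    ContDiff ℝ (⊤ : ℕ∞) (oscDeriv h) := by
  have h1 : ContDiff ℝ (⊤ : ℕ∞) fun p : V × V => (innerSL ℝ p.1).smulRight (h p) :=
    ((innerSL ℝ).contDiff.comp contDiff_fst).smulRight hs
  have h2 : ContDiff ℝ (⊤ : ℕ∞) fun p => (fderiv ℝ h p).comp (ContinuousLinearMap.inr ℝ V V) :=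
    (hs.fderiv_right (m := (⊤ : ℕ∞)) le_rfl).clm_comp contDiff_const
  exact (h1.const_smul (-(2 * Real.pi * Complex.I))).add h2

/-- Differentiating the phase brings down a factor `x`, which costs one power of decay;
differentiating the amplitude costs one derivative. The new constant collects `2π` with the Leibniz
factor `2 ^ K` from the first term and `1` from the second. -/
theorem DerivBound.oscDeriv {K d M : ℕ} {R : ℝ} {h : V × V → F} (hs : ContDiff ℝ (⊤ : ℕ∞) h)
    (hb : DerivBound (K + 1) (oscWeight V R d (M + 1)) h) (hR : 0 ≤ R) :
    DerivBound K (oscWeight V ((2 * Real.pi * 2 ^ K + 1) * R) d M) (oscDeriv h) := by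
  let L : V × V →L[ℝ] V →L[ℝ] ℝ := (innerSL ℝ).comp (ContinuousLinearMap.fst ℝ V V)
  have hL : ‖L‖ ≤ 1 := by
    refine L.opNorm_le_bound zero_le_one fun p => ?_
    change ‖innerSL ℝ p.1‖ ≤ _
    rw [innerSL_apply_norm, one_mul]
    exact norm_fst_le p
  have h1 : DerivBound K (fun p : V × V => 1 + ‖p.1‖) L :=
    (DerivBound.clm K L).mono le_rfl fun p => max_le
      (by
        change ‖innerSL ℝ p.1‖ ≤ _
        rw [innerSL_apply_norm]
        linarith)
      (hL.trans (by linarith [norm_nonneg p.1]))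
  have h2 := h1.smulRight (hb.mono (Nat.le_succ K) fun _ => le_rfl) L.contDiff hs
  have s2 : ContDiff ℝ (⊤ : ℕ∞) fun p : V × V => (L p).smulRight (h p) :=
    L.contDiff.smulRight hs
  let c : (V →L[ℝ] F) →L[ℝ] (V →L[ℝ] F) :=
    (-(2 * Real.pi * Complex.I)) • ContinuousLinearMap.id ℝ (V →L[ℝ] F)
  have hc : ‖c‖ ≤ 2 * Real.pi := by
    refine ContinuousLinearMap.opNorm_le_bound _ (by positivity) fun f => ?_
    change ‖(-(2 * Real.pi * Complex.I)) • f‖ ≤ _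
    rw [norm_smul]
    simp [abs_of_pos Real.pi_pos]
  have h3 := DerivBound.clm_comp c h2 s2
  have h4 := hb.fderiv
  have s4 : ContDiff ℝ (⊤ : ℕ∞) (_root_.fderiv ℝ h) := hs.fderiv_right le_rfl
  have h5 := h4.comp_const _ (ContinuousLinearMap.norm_inr_le_one ℝ V V) s4
  refine (h3.add h5 (c.contDiff.comp s2) (s4.clm_comp contDiff_const)).mono le_rfl fun p => ?_
  have e1 : (1 + ‖p.1‖) * oscWeight V R d (M + 1) p = oscWeight V R d M p := by
    have : 1 + ‖p.1‖ ≠ 0 := by positivity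
    unfold oscWeight
    field_simp
    ring
  have e2 : oscWeight V R d (M + 1) p ≤ oscWeight V R d M p := by
    unfold oscWeight
    gcongr
    · linarith [norm_nonneg p.1]
    · omega
  have e3 : oscWeight V ((2 * Real.pi * 2 ^ K + 1) * R) d M p
      = 2 * Real.pi * (2 ^ K * oscWeight V R d M p) + oscWeight V R d M p := by
    unfold oscWeight
    ring
  have e4 : 0 ≤ oscWeight V R d M p := by unfold oscWeight; positivity
  rw [e3, e1]
  gcongr

theorem DerivBound.comp_inl {K d M : ℕ} {R : ℝ} {h : V × V → F} (hs : ContDiff ℝ (⊤ : ℕ∞) h)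
    (hb : DerivBound (K + 1) (oscWeight V R d M) h) :
    DerivBound K (oscWeight V R d M)
      (fun p => (_root_.fderiv ℝ h p).comp (ContinuousLinearMap.inl ℝ V V)) :=
  hb.fderiv.comp_const _ (ContinuousLinearMap.norm_inl_le_one ℝ V V) (hs.fderiv_right le_rfl)

variable [FiniteDimensional ℝ V] [MeasurableSpace V] [BorelSpace V]

/-- The oscillatory integral `∫ e^{-2πi x·ζ} h(x, ζ) dx`. -/
noncomputable def oscIntegral (h : V × V → F) (ζ : V) : F := 𝓕 (fun x => h (x, ζ)) ζ

theorem integrable_inv_one_add_norm_pow {M : ℕ} (hM : Module.finrank ℝ V + 1 ≤ M) :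
    Integrable fun x : V => ((1 + ‖x‖) ^ M)⁻¹ := by
  have := integrable_one_add_norm (E := V) (μ := volume) (r := M) (by exact_mod_cast hM)
  refine this.congr (Eventually.of_forall fun x => ?_)
  simp only
  rw [Real.rpow_neg (by positivity), Real.rpow_natCast]

theorem integrable_of_le_oscWeight {F : Type u} [NormedAddCommGroup F] {R : ℝ} {d M : ℕ}
    (hM : Module.finrank ℝ V + 1 ≤ M)
    {h : V × V → F} (hc : Continuous h) (hb : ∀ p, ‖h p‖ ≤ oscWeight V R d M p) (ζ : V) :
    Integrable fun x => h (x, ζ) := by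
  refine ((integrable_inv_one_add_norm_pow hM).const_mul (R * (1 + ‖ζ‖) ^ d)).mono'
    (by fun_prop) (Eventually.of_forall fun x => hb (x, ζ))

theorem norm_oscIntegral_le {R : ℝ} {d M : ℕ} (hM : Module.finrank ℝ V + 1 ≤ M)
    {h : V × V → F} (hb : ∀ p, ‖h p‖ ≤ oscWeight V R d M p) (ζ : V) :
    ‖oscIntegral h ζ‖ ≤ (∫ x : V, ((1 + ‖x‖) ^ M)⁻¹) * R * (1 + ‖ζ‖) ^ d := by
  rw [oscIntegral, Real.fourier_eq]
  refine (norm_integral_le_of_norm_le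
    (((integrable_inv_one_add_norm_pow hM).const_mul (R * (1 + ‖ζ‖) ^ d)))
    (Eventually.of_forall fun x => ?_)).trans_eq ?_
  · rw [Circle.norm_smul]
    exact hb (x, ζ)
  · rw [integral_const_mul]
    ring

theorem hasFDerivAt_oscIntegral {R : ℝ} {d M : ℕ} (hM : Module.finrank ℝ V + 1 ≤ M)
    {h : V × V → F} (hs : ContDiff ℝ (⊤ : ℕ∞) h) (hb : ∀ p, ‖h p‖ ≤ oscWeight V R d M p)
    (hb' : ∀ p, ‖oscDeriv h p‖ ≤ oscWeight V R d M p) (hR : 0 ≤ R) (ζ : V) :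
    HasFDerivAt (oscIntegral h) (oscIntegral (oscDeriv h) ζ) ζ := by
  have hd : Continuous (oscDeriv h) := (contDiff_oscDeriv hs).continuous
  have hI : ∀ ζ, Integrable fun x => Real.fourierChar (-inner ℝ x ζ) • h (x, ζ) := fun ζ =>
    (Real.fourierIntegral_convergent_iff ζ).2 (integrable_of_le_oscWeight hM hs.continuous hb ζ)
  have key := hasFDerivAt_integral_of_dominated_of_fderiv_le (𝕜 := ℝ) (μ := (volume : Measure V))
    (F := fun ζ x => Real.fourierChar (-inner ℝ x ζ) • h (x, ζ))
    (F' := fun ζ x => Real.fourierChar (-inner ℝ x ζ) • oscDeriv h (x, ζ)) (x₀ := ζ)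
    -- On the unit ball around `ζ` one has `1 + ‖ζ'‖ ≤ 2 + ‖ζ‖`, so this bound serves for all these
    -- `ζ'`.
    (bound := fun x => (R * (2 + ‖ζ‖) ^ d) * ((1 + ‖x‖) ^ M)⁻¹)
    (Metric.ball_mem_nhds ζ one_pos)
    (Eventually.of_forall fun ζ' => (hI ζ').aestronglyMeasurable) (hI ζ)
    ((Real.fourierIntegral_convergent_iff ζ).2
      (integrable_of_le_oscWeight hM hd hb' ζ)).aestronglyMeasurable
    (Eventually.of_forall fun x ζ' hζ' => ?_)
    ((integrable_inv_one_add_norm_pow hM).const_mul _)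
    (Eventually.of_forall fun x ζ' _ => ?_)
  · exact key
  · refine ((Circle.norm_smul _ (oscDeriv h (x, ζ'))).trans_le (hb' (x, ζ'))).trans ?_
    have : ‖ζ'‖ ≤ 1 + ‖ζ‖ := by
      have := norm_le_norm_add_norm_sub' ζ' ζ
      have := mem_ball_iff_norm.1 hζ'
      linarith
    have : 1 + ‖ζ'‖ ≤ 2 + ‖ζ‖ := by linarith
    exact mul_le_mul_of_nonneg_right (mul_le_mul_of_nonneg_left
      (pow_le_pow_left₀ (by positivity) this d) hR) (by positivity)
  · have h1 := Real.hasFDerivAt_fourierChar_neg_bilinear_right (innerSL ℝ) x ζ'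
    have h2 : HasFDerivAt (fun ζ => h (x, ζ)) _ ζ' :=
      HasFDerivAt.comp (f := fun ζ => (x, ζ)) ζ'
        ((hs.differentiable (by simp)).differentiableAt (x := (x, ζ'))).hasFDerivAt
        (hasFDerivAt_prodMk_right x ζ')
    refine (h1.smul h2).congr_fderiv ?_
    ext v
    simp only [oscDeriv, Circle.smul_def, smul_smul, smul_add, add_apply, smul_apply,
      ContinuousLinearMap.comp_apply, ContinuousLinearMap.smulRight_apply,
      ContinuousLinearMap.smulRightL_apply_apply, Complex.ofRealCLM_apply, smul_eq_mul]
    rw [add_comm]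
    congr 1
    · simp only [← Complex.coe_smul, smul_smul, innerSL_apply_apply]
      congr 1
      ring_nf
      rfl

/-- Integration by parts in `x` at fixed `ζ`: the Fourier transform turns the `x`-derivative of the
amplitude into multiplication by `2πi ζ`. -/
theorem norm_mul_norm_oscIntegral {R : ℝ} {d M : ℕ} (hM : Module.finrank ℝ V + 1 ≤ M)
    {h : V × V → F} (hs : ContDiff ℝ (⊤ : ℕ∞) h) (hb : ∀ p, ‖h p‖ ≤ oscWeight V R d M p)
    (hb' : ∀ p, ‖fderiv ℝ h p‖ ≤ oscWeight V R d M p) (ζ : V) :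
    2 * Real.pi * (‖ζ‖ * ‖oscIntegral h ζ‖) =
      ‖oscIntegral (fun p => (fderiv ℝ h p).comp (ContinuousLinearMap.inl ℝ V V)) ζ‖ := by
  have h0 : ∀ x, HasFDerivAt (fun x => h (x, ζ))
      ((fderiv ℝ h (x, ζ)).comp (ContinuousLinearMap.inl ℝ V V)) x := fun x =>
    HasFDerivAt.comp (f := fun x => (x, ζ)) x
        ((hs.differentiable (by simp)).differentiableAt (x := (x, ζ))).hasFDerivAt
        (hasFDerivAt_prodMk_left x ζ)
  have h1 : Continuous (fderiv ℝ h) := hs.continuous_fderiv (by simp)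
  have h2 : (fun x => (fderiv ℝ h (x, ζ)).comp (ContinuousLinearMap.inl ℝ V V))
      = fderiv ℝ (fun x => h (x, ζ)) := funext fun x => (h0 x).fderiv.symm
  have h3 := Real.fourier_fderiv (integrable_of_le_oscWeight hM hs.continuous hb ζ)
    (fun x => (h0 x).differentiableAt)
    (by
      rw [← h2]
      refine integrable_of_le_oscWeight (R := R) (d := d) (h := fun p => (fderiv ℝ h p).comp
        (ContinuousLinearMap.inl ℝ V V)) hM (h1.clm_comp_const _) (fun p => ?_) ζ
      refine ((ContinuousLinearMap.opNorm_comp_le _ _).trans ?_).trans (hb' p)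
      exact mul_le_of_le_one_right (norm_nonneg _) (ContinuousLinearMap.norm_inl_le_one ℝ V V))
  unfold oscIntegral
  rw [h2, h3, VectorFourier.norm_fourierSMulRight]
  rw [neg_apply, norm_neg, innerSL_apply_norm]
  ring

/-- Integrate by parts `k` times; the factors `2π ≥ 1` gained on the way are discarded. -/
theorem pow_mul_norm_oscIntegral_le {k d M : ℕ} {R : ℝ} (hM : Module.finrank ℝ V + 1 ≤ M)
    {h : V × V → F} (hs : ContDiff ℝ (⊤ : ℕ∞) h) (hb : DerivBound k (oscWeight V R d M) h)
    (ζ : V) :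
    ‖ζ‖ ^ k * ‖oscIntegral h ζ‖ ≤ (∫ x : V, ((1 + ‖x‖) ^ M)⁻¹) * R * (1 + ‖ζ‖) ^ d := by
  induction k generalizing F with
  | zero =>
    rw [pow_zero, one_mul]
    exact norm_oscIntegral_le hM hb.norm_le ζ
  | succ k ih =>
    have h1 := norm_mul_norm_oscIntegral hM hs hb.norm_le (fun p => hb.fderiv.norm_le p) ζ
    have h2 := ih (h := fun p => (fderiv ℝ h p).comp (ContinuousLinearMap.inl ℝ V V))
      ((hs.fderiv_right (m := (⊤ : ℕ∞)) le_rfl).clm_comp contDiff_const) (hb.comp_inl hs)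
    refine le_trans ?_ h2
    rw [← h1, pow_succ, mul_assoc]
    have h0 : 0 ≤ ‖ζ‖ * ‖oscIntegral h ζ‖ := by positivity
    exact mul_le_mul_of_nonneg_left (by nlinarith [Real.pi_gt_three]) (by positivity)

/-- The derivatives of an oscillatory integral are controlled by finitely many derivatives of its
amplitude. -/
theorem pow_mul_norm_iteratedFDeriv_oscIntegral_le (k l d : ℕ) :
    -- The constant precedes `F` because the induction on `l` applies the bound to `oscDeriv h`,
    -- which takes values in `V →L[ℝ] F`.
    ∃ C : ℝ, 0 ≤ C ∧ ∀ {F : Type u} [NormedAddCommGroup F] [NormedSpace ℂ F] {R : ℝ}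
      {h : V × V → F}, 0 ≤ R → ContDiff ℝ (⊤ : ℕ∞) h →
      DerivBound (k + l) (oscWeight V R d (Module.finrank ℝ V + 1 + l)) h → ∀ ζ,
      ‖ζ‖ ^ k * ‖iteratedFDeriv ℝ l (oscIntegral h) ζ‖ ≤ C * R * (1 + ‖ζ‖) ^ d := by
  induction l with
  | zero =>
    refine ⟨∫ x : V, ((1 + ‖x‖) ^ (Module.finrank ℝ V + 1))⁻¹,
      integral_nonneg fun x => by positivity, fun {F} _ _ {R} {h} hR hs hb ζ => ?_⟩
    rw [norm_iteratedFDeriv_zero]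
    exact pow_mul_norm_oscIntegral_le le_rfl hs hb ζ
  | succ l ih =>
    obtain ⟨C, hC, ih⟩ := ih
    refine ⟨C * (2 * Real.pi * 2 ^ (k + l) + 1), by positivity,
      fun {F} _ _ {R} {h} hR hs hb ζ => ?_⟩
    have h1 := DerivBound.oscDeriv (K := k + l) hs hb hR
    have h2 := ih (by positivity) (contDiff_oscDeriv hs) h1 ζ
    have h3 : fderiv ℝ (oscIntegral h) = oscIntegral (oscDeriv h) := funext fun ζ => by
      refine (hasFDerivAt_oscIntegral (R := (2 * Real.pi * 2 ^ (k + l) + 1) * R) (d := d)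
        (M := Module.finrank ℝ V + 1 + l) (by omega) hs (fun p => ?_) h1.norm_le
        (by positivity) ζ).fderiv
      refine (hb.norm_le p).trans ((oscWeight_anti hR d
        (M' := Module.finrank ℝ V + 1 + l) (by omega) p).trans ?_)
      unfold oscWeight
      gcongr
      refine le_mul_of_one_le_left hR ?_
      have := Real.pi_pos
      linarith [show 0 ≤ 2 * Real.pi * 2 ^ (k + l) by positivity]
    rw [← norm_iteratedFDeriv_fderiv, h3, mul_assoc C]
    exact h2

/-- Amplitudes bounded for all `K` and `M` are stable under `oscDeriv`, so differentiation under the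
integral can be repeated indefinitely. -/
theorem contDiff_oscIntegral {d : ℕ} {h : V × V → F} (hs : ContDiff ℝ (⊤ : ℕ∞) h)
    (hb : ∀ K M, ∃ R, 0 ≤ R ∧ DerivBound K (oscWeight V R d M) h) :
    ContDiff ℝ (⊤ : ℕ∞) (oscIntegral h) := by
  refine contDiff_infty.2 fun N => ?_
  have hd : ∀ {F : Type u} [NormedAddCommGroup F] [NormedSpace ℂ F] {h : V × V → F},
      ContDiff ℝ (⊤ : ℕ∞) h → (∀ K M, ∃ R, 0 ≤ R ∧ DerivBound K (oscWeight V R d M) h) →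
      ∀ ζ, HasFDerivAt (oscIntegral h) (oscIntegral (oscDeriv h) ζ) ζ := by
    intro F _ _ h hs hb ζ
    obtain ⟨R, hR, h1⟩ := hb 1 (Module.finrank ℝ V + 1 + 1)
    have h2 := DerivBound.oscDeriv (K := 0) hs h1 hR
    refine hasFDerivAt_oscIntegral le_rfl hs (fun p => ?_) h2.norm_le (by positivity) ζ
    refine (h1.norm_le p).trans ((oscWeight_anti hR d
      (M' := Module.finrank ℝ V + 1) (by omega) p).trans ?_)
    unfold oscWeight
    gcongr
    refine le_mul_of_one_le_left hR ?_
    linarith [show 0 ≤ 2 * Real.pi * 2 ^ 0 by positivity]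
  induction N generalizing F with
  | zero =>
    exact contDiff_zero.2 (continuous_iff_continuousAt.2 fun ζ => (hd hs hb ζ).continuousAt)
  | succ N ih =>
    push_cast
    rw [contDiff_succ_iff_fderiv]
    refine ⟨fun ζ => (hd hs hb ζ).differentiableAt, by simp, ?_⟩
    rw [show fderiv ℝ (oscIntegral h) = oscIntegral (oscDeriv h) from
      funext fun ζ => (hd hs hb ζ).fderiv]
    refine ih (contDiff_oscDeriv hs) fun K M => ?_
    obtain ⟨R, hR, h1⟩ := hb (K + 1) (M + 1)
    exact ⟨_, by positivity, DerivBound.oscDeriv hs h1 hR⟩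

end Oscillatory

/-! ### Amplitudes and the transforms they define on the Schwartz space -/

section Amplitudes

variable {V : Type} [NormedAddCommGroup V] [InnerProductSpace ℝ V]

/-- The amplitudes of order `d`: all derivatives grow at most like `(1 + ‖ξ‖) ^ d`. -/
def IsAmplitude (d : ℕ) (c : V × V → ℂ) : Prop :=
  ContDiff ℝ (⊤ : ℕ∞) c ∧
    ∀ K, ∃ C, 0 ≤ C ∧ DerivBound K (fun p : V × V => C * (1 + ‖p.2‖) ^ d) c

theorem derivBound_schwartz (K M : ℕ) (ψ : 𝓢(V, ℂ)) :
    DerivBound K (fun x => 2 ^ M * (Finset.Iic (M, K)).sup (schwartzSeminormFamily ℂ V ℂ) ψ *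
      ((1 + ‖x‖) ^ M)⁻¹) ψ := fun k hk x => by
  have h := SchwartzMap.one_add_le_sup_seminorm_apply (𝕜 := ℂ) (m := (M, K)) le_rfl hk ψ x
  dsimp only
  rw [← div_eq_mul_inv, le_div_iff₀ (by positivity), mul_comm]
  exact h

theorem derivBound_schwartz_fst (K M : ℕ) (ψ : 𝓢(V, ℂ)) :
    DerivBound K (fun p : V × V => 2 ^ M *
      (Finset.Iic (M, K)).sup (schwartzSeminormFamily ℂ V ℂ) ψ * ((1 + ‖p.1‖) ^ M)⁻¹)
      (fun p : V × V => ψ p.1) := by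
  refine ((derivBound_schwartz K M ψ).comp_clm (ContinuousLinearMap.fst ℝ V V)
    (ψ.smooth _)).mono le_rfl fun p => ?_
  rw [max_eq_left (ContinuousLinearMap.norm_fst_le ..), one_pow, one_mul]
  rfl

theorem contDiff_schwartz_fst (ψ : 𝓢(V, ℂ)) :
    ContDiff ℝ (⊤ : ℕ∞) (fun p : V × V => ψ p.1) := (ψ.smooth _).comp contDiff_fst

theorem DerivBound.mul_complex {X : Type} [NormedAddCommGroup X] [NormedSpace ℝ X] {K : ℕ}
    {w₁ w₂ : X → ℝ} {f g : X → ℂ} (h₁ : DerivBound K w₁ f) (h₂ : DerivBound K w₂ g)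
    (hf : ContDiff ℝ (⊤ : ℕ∞) f) (hg : ContDiff ℝ (⊤ : ℕ∞) g) :
    DerivBound K (fun p => 2 ^ K * (w₁ p * w₂ p)) (fun p => f p * g p) :=
  h₁.bilin (ContinuousLinearMap.mul ℝ ℂ) (ContinuousLinearMap.opNorm_mul_le ℝ ℂ) h₂ hf hg

theorem DerivBound.mul_schwartz {K d : ℕ} {R : ℝ} {c : V × V → ℂ}
    (hc : ContDiff ℝ (⊤ : ℕ∞) c)
    (hb : DerivBound K (fun p : V × V => R * (1 + ‖p.2‖) ^ d) c) (M : ℕ) (ψ : 𝓢(V, ℂ)) :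
    DerivBound K (oscWeight V
      (2 ^ (K + M) * R * (Finset.Iic (M, K)).sup (schwartzSeminormFamily ℂ V ℂ) ψ) d M)
      (fun p => c p * ψ p.1) := by
  refine (hb.mul_complex (derivBound_schwartz_fst K M ψ) hc (contDiff_schwartz_fst ψ)).mono
    le_rfl fun p => le_of_eq ?_
  unfold oscWeight
  ring

/-- After the swap the growth of `c` sits in the variable where `ψ` decays: `d` extra powers of
decay of `ψ` absorb it, and the weight has growth order `0`. -/
theorem DerivBound.swap_mul_schwartz {K d : ℕ} {R : ℝ} {c : V × V → ℂ}
    (hc : ContDiff ℝ (⊤ : ℕ∞) c)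
    (hb : DerivBound K (fun p : V × V => R * (1 + ‖p.2‖) ^ d) c) (M : ℕ) (ψ : 𝓢(V, ℂ)) :
    DerivBound K (oscWeight V (2 ^ (K + (M + d)) * R *
      (Finset.Iic (M + d, K)).sup (schwartzSeminormFamily ℂ V ℂ) ψ) 0 M)
      (fun p => c p.swap * ψ p.1) := by
  let L : V × V →L[ℝ] V × V :=
    (ContinuousLinearMap.snd ℝ V V).prod (ContinuousLinearMap.fst ℝ V V)
  have hL : ‖L‖ ≤ 1 := by
    refine L.opNorm_le_bound zero_le_one fun p => ?_
    rw [one_mul]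
    exact (max_comm ‖p.2‖ ‖p.1‖).le
  refine ((hb.comp_clm L hc).mul_complex (derivBound_schwartz_fst K (M + d) ψ)
    (hc.comp L.contDiff) (contDiff_schwartz_fst ψ)).mono le_rfl fun p => le_of_eq ?_
  rw [max_eq_left hL]
  unfold oscWeight
  have : (1 + ‖p.1‖) ≠ 0 := by positivity
  change 2 ^ K * (1 ^ K * (R * (1 + ‖p.1‖) ^ d) * _) = _
  field_simp
  ring

theorem IsAmplitude.exists_oscWeight {d : ℕ} {c : V × V → ℂ} (hc : IsAmplitude d c)
    (ψ : 𝓢(V, ℂ)) (K M : ℕ) :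
    ∃ R, 0 ≤ R ∧ DerivBound K (oscWeight V R d M) (fun p => c p * ψ p.1) := by
  obtain ⟨C, hC, hb⟩ := hc.2 K
  exact ⟨_, by positivity, hb.mul_schwartz hc.1 M ψ⟩

/-- The exponent `K + d` collects `K` factors from the chain rule and `d` from rescaling the weight.
-/
theorem DerivBound.comp_smul {K d : ℕ} {R : ℝ} (hR : 0 ≤ R) {c : V × V → ℂ}
    (hc : ContDiff ℝ (⊤ : ℕ∞) c)
    (hb : DerivBound K (fun p : V × V => R * (1 + ‖p.2‖) ^ d) c) (t : ℝ) :
    DerivBound K (fun p : V × V => max 1 |t| ^ (K + d) * R * (1 + ‖p.2‖) ^ d)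
      (fun p : V × V => c (p.1, t • p.2)) := by
  let L : V × V →L[ℝ] V × V :=
    (ContinuousLinearMap.fst ℝ V V).prod (t • ContinuousLinearMap.snd ℝ V V)
  have hL : ‖L‖ ≤ max 1 |t| := by
    refine L.opNorm_le_bound (by positivity) fun p => max_le ?_ ?_
    · calc ‖p.1‖ ≤ ‖p‖ := norm_fst_le p
        _ ≤ _ := le_mul_of_one_le_left (norm_nonneg p) (le_max_left ..)
    · change ‖t • p.2‖ ≤ _
      rw [norm_smul]
      exact mul_le_mul (le_max_right ..) (norm_snd_le p) (norm_nonneg _) (by positivity)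
  refine (hb.comp_clm L hc).mono le_rfl fun p => ?_
  change max 1 ‖L‖ ^ K * (R * (1 + ‖t • p.2‖) ^ d) ≤ _
  have h1 : 1 + ‖t • p.2‖ ≤ max 1 |t| * (1 + ‖p.2‖) := by
    rw [norm_smul, mul_add, mul_one]
    gcongr
    · exact le_max_left ..
    · exact le_max_right ..
  calc _ ≤ max 1 |t| ^ K * (R * (max 1 |t| * (1 + ‖p.2‖)) ^ d) := by
        have : max 1 ‖L‖ ≤ max 1 |t| := max_le (le_max_left ..) hL
        gcongr
    _ = _ := by
        rw [mul_pow, pow_add]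
        ring

theorem IsAmplitude.comp_smul {d : ℕ} {c : V × V → ℂ} (hc : IsAmplitude d c) (t : ℝ) :
    IsAmplitude d fun p : V × V => c (p.1, t • p.2) := by
  refine ⟨hc.1.comp (by fun_prop : ContDiff ℝ _ fun p : V × V => (p.1, t • p.2)), fun K => ?_⟩
  obtain ⟨C, hC, hb⟩ := hc.2 K
  exact ⟨_, by positivity, hb.comp_smul hC hc.1 t⟩

variable [FiniteDimensional ℝ V] [MeasurableSpace V] [BorelSpace V]

/-- Growth of order `d` is removed by `d` further powers of decay, through `(1 + r) ^ d ≤ 2 ^ d * (1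
+ r ^ d)`. -/
theorem le_of_le_one_add_pow {r N A B : ℝ} (hr : 0 ≤ r) (hN : 0 ≤ N) (k d : ℕ)
    (h₁ : r ^ k * N ≤ A * (1 + r) ^ d) (h₂ : r ^ (k + d) * N ≤ B * (1 + r) ^ d) :
    r ^ k * N ≤ 2 ^ d * (A + B) := by
  have h3 : (1 + r) ^ d ≤ 2 ^ d * (1 + r ^ d) := by
    rcases le_total r 1 with h | h
    · calc (1 + r) ^ d ≤ 2 ^ d := by gcongr; linarith
        _ ≤ 2 ^ d * (1 + r ^ d) := le_mul_of_one_le_right (by positivity)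
            (by linarith [pow_nonneg hr d])
    · calc (1 + r) ^ d ≤ (2 * r) ^ d := by gcongr; linarith
        _ = 2 ^ d * r ^ d := mul_pow ..
        _ ≤ 2 ^ d * (1 + r ^ d) := by gcongr; linarith
  have h4 : 0 < (1 + r) ^ d := by positivity
  refine le_of_mul_le_mul_right ?_ h4
  calc r ^ k * N * (1 + r) ^ d ≤ r ^ k * N * (2 ^ d * (1 + r ^ d)) := by gcongr
    _ = 2 ^ d * (r ^ k * N + r ^ (k + d) * N) := by ring
    _ ≤ 2 ^ d * (A * (1 + r) ^ d + B * (1 + r) ^ d) := by gcongr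
    _ = _ := by ring

/-- Decay of oscillatory integrals with finitely many bounds on the amplitude. -/
theorem exists_decay_oscIntegral (k l d : ℕ) :
    ∃ C : ℝ, 0 ≤ C ∧ ∀ {R : ℝ} {h : V × V → ℂ}, 0 ≤ R → ContDiff ℝ (⊤ : ℕ∞) h →
      DerivBound (k + d + l) (oscWeight V R d (Module.finrank ℝ V + 1 + l)) h → ∀ ζ,
      ‖ζ‖ ^ k * ‖iteratedFDeriv ℝ l (oscIntegral h) ζ‖ ≤ C * R := by
  obtain ⟨C₁, hC₁, h₁⟩ := pow_mul_norm_iteratedFDeriv_oscIntegral_le (V := V) k l d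
  obtain ⟨C₂, hC₂, h₂⟩ := pow_mul_norm_iteratedFDeriv_oscIntegral_le (V := V) (k + d) l d
  refine ⟨2 ^ d * (C₁ + C₂), by positivity, fun {R h} hR hs hb ζ => ?_⟩
  have := le_of_le_one_add_pow (norm_nonneg ζ) (norm_nonneg _) k d
    (h₁ hR hs (hb.mono (by omega) fun _ => le_rfl) ζ) (h₂ hR hs hb ζ)
  exact this.trans_eq (by ring)

theorem exists_schwartz_eq_oscIntegral {d : ℕ} {h : V × V → ℂ} (hs : ContDiff ℝ (⊤ : ℕ∞) h)
    (hb : ∀ K M, ∃ R, 0 ≤ R ∧ DerivBound K (oscWeight V R d M) h) :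
    ∃ f : 𝓢(V, ℂ), ∀ x, f x = oscIntegral h x := by
  refine ⟨⟨oscIntegral h, contDiff_oscIntegral hs hb, fun k l => ?_⟩, fun _ => rfl⟩
  obtain ⟨C, hC, h1⟩ := exists_decay_oscIntegral (V := V) k l d
  obtain ⟨R, hR, h2⟩ := hb (k + d + l) (Module.finrank ℝ V + 1 + l)
  exact ⟨C * R, h1 hR hs h2⟩

/-- The function `ζ ↦ ∫ e^{-2πi x·ζ} c(x, ζ) ψ(x) dx`. -/
noncomputable def ampTransform (c : V × V → ℂ) (ψ : V → ℂ) : V → ℂ :=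
  oscIntegral fun p => c p * ψ p.1

/-- The indices and the constant do not depend on `c`, and `R` enters linearly. The later limits
rest on this: a small amplitude gives a small operator. -/
theorem exists_decay_ampTransform (k l d : ℕ) :
    ∃ K M : ℕ, ∃ C : ℝ, 0 ≤ C ∧ ∀ {R : ℝ} {c : V × V → ℂ}, 0 ≤ R → ContDiff ℝ (⊤ : ℕ∞) c →
      DerivBound K (fun p : V × V => R * (1 + ‖p.2‖) ^ d) c → ∀ (ψ : 𝓢(V, ℂ)) (ζ : V),
      ‖ζ‖ ^ k * ‖iteratedFDeriv ℝ l (ampTransform c ψ) ζ‖ ≤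
        C * R * (Finset.Iic (M, K)).sup (schwartzSeminormFamily ℂ V ℂ) ψ := by
  obtain ⟨C, hC, h⟩ := exists_decay_oscIntegral (V := V) k l d
  refine ⟨k + d + l, Module.finrank ℝ V + 1 + l,
    C * 2 ^ (k + d + l + (Module.finrank ℝ V + 1 + l)), by positivity,
    fun {R c} hR hc hb ψ ζ => ?_⟩
  refine (h (by positivity) (hc.mul (contDiff_schwartz_fst ψ))
    (hb.mul_schwartz hc _ ψ) ζ).trans_eq ?_
  ring

namespace IsAmplitude

variable {d : ℕ} {c : V × V → ℂ}

theorem integrable (hc : IsAmplitude d c) (ψ : 𝓢(V, ℂ)) (ζ : V) :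
    Integrable fun x => c (x, ζ) * ψ x := by
  obtain ⟨R, hR, hb⟩ := hc.exists_oscWeight ψ 0 (Module.finrank ℝ V + 1)
  exact integrable_of_le_oscWeight le_rfl (hc.1.continuous.mul (contDiff_schwartz_fst ψ).continuous)
    hb.norm_le ζ

theorem ampTransform_add (hc : IsAmplitude d c) (ψ₁ ψ₂ : 𝓢(V, ℂ)) (ζ : V) :
    ampTransform c (ψ₁ + ψ₂ : 𝓢(V, ℂ)) ζ = ampTransform c ψ₁ ζ + ampTransform c ψ₂ ζ := by
  simp only [ampTransform, oscIntegral, Real.fourier_eq]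
  rw [← integral_add ((Real.fourierIntegral_convergent_iff ζ).2 (hc.integrable ψ₁ ζ))
    ((Real.fourierIntegral_convergent_iff ζ).2 (hc.integrable ψ₂ ζ))]
  congr 1
  ext x
  rw [add_apply, mul_add, smul_add]

/-- The transform `ψ ↦ ∫ e^{-2πi x·ζ} c(x, ζ) ψ(x) dx` on the Schwartz space. -/
noncomputable def transformCLM (hc : IsAmplitude d c) : 𝓢(V, ℂ) →L[ℂ] 𝓢(V, ℂ) :=
  SchwartzMap.mkCLM (fun ψ => ampTransform c ψ) hc.ampTransform_add
    (fun a ψ ζ => by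
      simp only [ampTransform, oscIntegral, Real.fourier_eq, RingHom.id_apply, smul_eq_mul,
        smul_apply]
      rw [← integral_const_mul]
      congr 1
      ext x
      simp only [Circle.smul_def, smul_eq_mul]
      ring)
    (fun ψ => contDiff_oscIntegral (hc.1.mul (contDiff_schwartz_fst ψ)) (hc.exists_oscWeight ψ))
    (fun m => by
      obtain ⟨K, M, C, hC, h⟩ := exists_decay_ampTransform (V := V) m.1 m.2 d
      obtain ⟨R, hR, hb⟩ := hc.2 K
      exact ⟨Finset.Iic (M, K), C * R, by positivity, h hR hc.1 hb⟩)

theorem transformCLM_apply (hc : IsAmplitude d c) (ψ : 𝓢(V, ℂ)) (ζ : V) :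
    hc.transformCLM ψ ζ = ampTransform c ψ ζ := rfl

/-- With the variables swapped, the integration runs over the frequency variable; this is the form
of `OP(a)φ`, which is thereby a Schwartz function. -/
theorem exists_schwartz (hc : IsAmplitude d c) (ψ : 𝓢(V, ℂ)) :
    ∃ f : 𝓢(V, ℂ), ∀ x, f x = ampTransform (fun p => c p.swap) ψ x := by
  refine exists_schwartz_eq_oscIntegral (d := 0)
    ((hc.1.comp (by fun_prop : ContDiff ℝ _ fun p : V × V => (p.2, p.1))).mul
      (contDiff_schwartz_fst ψ)) fun K M => ?_
  obtain ⟨C, hC, hb⟩ := hc.2 K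
  exact ⟨_, by positivity, hb.swap_mul_schwartz hc.1 M ψ⟩

/-- Fubini: swapping the variables of the amplitude transposes the transform. The double integral
converges absolutely, since the decay of `φ` beats the growth of `c`. -/
theorem integral_ampTransform_mul (hc : IsAmplitude d c) (ψ φ : 𝓢(V, ℂ)) :
    ∫ ζ, ampTransform c ψ ζ * φ ζ = ∫ x, ψ x * ampTransform (fun p => c p.swap) φ x := by
  obtain ⟨C, hC, hb⟩ := hc.2 0
  have hint : Integrable (Function.uncurry fun ζ x : V =>
      (Real.fourierChar (-inner ℝ x ζ) : ℂ) * (c (x, ζ) * ψ x * φ ζ))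
      (volume.prod volume) := by
    have h1 : Integrable fun ζ : V => C * (‖φ ζ‖ * (1 + ‖ζ‖) ^ d) := by
      refine Integrable.const_mul ?_ C
      have hM := derivBound_schwartz 0 (Module.finrank ℝ V + 1 + d) φ
      refine ((integrable_inv_one_add_norm_pow (V := V) le_rfl).const_mul
        (2 ^ (Module.finrank ℝ V + 1 + d) *
          (Finset.Iic (Module.finrank ℝ V + 1 + d, 0)).sup (schwartzSeminormFamily ℂ V ℂ) φ)).mono'
        (by fun_prop) (Eventually.of_forall fun ζ => ?_)
      rw [Real.norm_of_nonneg (by positivity)]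
      have h3 : 1 + ‖ζ‖ ≠ 0 := by positivity
      have h4 : ∀ (A : ℝ) (m : ℕ),
          A * ((1 + ‖ζ‖) ^ (m + d))⁻¹ * (1 + ‖ζ‖) ^ d = A * ((1 + ‖ζ‖) ^ m)⁻¹ := fun A m => by
        rw [pow_add]
        field_simp
      calc ‖φ ζ‖ * (1 + ‖ζ‖) ^ d ≤ _ * (1 + ‖ζ‖) ^ d :=
            mul_le_mul_of_nonneg_right (hM.norm_le ζ) (by positivity)
        _ = _ := h4 _ _
    have h2 := h1.mul_prod (ψ.integrable (μ := (volume : Measure V))).norm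
    refine h2.mono' ?_ (Eventually.of_forall fun p => ?_)
    · refine Continuous.aestronglyMeasurable ?_
      have h4 := hc.1.continuous
      have h5 := ψ.continuous
      have h6 := φ.continuous
      have h7 : Continuous fun p : V × V => Real.fourierChar (-inner ℝ p.2 p.1) :=
        Real.continuous_fourierChar.comp (by fun_prop)
      unfold Function.uncurry
      fun_prop
    · simp only [Function.uncurry, norm_mul, Circle.norm_coe, one_mul]
      have := hb.norm_le (p.2, p.1)
      calc ‖c (p.2, p.1)‖ * ‖ψ p.2‖ * ‖φ p.1‖ ≤ (C * (1 + ‖p.1‖) ^ d) * ‖ψ p.2‖ * ‖φ p.1‖ := by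
            gcongr
        _ = _ := by ring
  simp only [ampTransform, oscIntegral, Real.fourier_eq]
  calc _ = ∫ ζ, ∫ x, (Real.fourierChar (-inner ℝ x ζ) : ℂ) * (c (x, ζ) * ψ x * φ ζ) := by
        congr 1
        ext ζ
        rw [← integral_mul_const]
        congr 1
        ext x
        simp only [Circle.smul_def, smul_eq_mul]
        ring
    _ = ∫ x, ∫ ζ, (Real.fourierChar (-inner ℝ x ζ) : ℂ) * (c (x, ζ) * ψ x * φ ζ) :=
        integral_integral_swap hint
    _ = _ := by
        congr 1
        ext x
        rw [← integral_const_mul]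
        congr 1
        ext ζ
        simp only [Circle.smul_def, smul_eq_mul, Prod.swap_prod_mk, real_inner_comm]
        ring

end IsAmplitude

end Amplitudes

/-! ### Pseudo-differential operators on tempered distributions -/

section Operators

variable {n d : ℕ} {a b : Euc n → Euc n → ℂ}

/-- Substitute `ξ = -2πζ`: the Jacobian cancels `(2π)⁻ⁿ`, the phase becomes `e^{-2πi x·ζ}`, and `𝓕 φ
(-ζ) = 𝓕⁻ φ ζ`. -/
theorem opSchwartz_eq_ampTransform (a : Euc n → Euc n → ℂ) (φ : 𝓢(Euc n, ℂ)) (x : Euc n) :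
    opSchwartz a φ x =
      ampTransform (fun p : Euc n × Euc n => a p.2 (-(2 * Real.pi) • p.1))
        (𝓕⁻ φ : 𝓢(Euc n, ℂ)) x := by
  have h := Measure.integral_comp_smul (volume : Measure (Euc n))
    (fun ξ : Euc n => Complex.exp (Complex.I * (inner ℝ x ξ : ℝ)) * a x ξ *
      𝓕 φ ((2 * Real.pi)⁻¹ • ξ)) (-(2 * Real.pi))
  have h2 : |((-(2 * Real.pi)) ^ Module.finrank ℝ (Euc n))⁻¹| = ((2 * Real.pi) ^ n)⁻¹ := by
    rw [finrank_euclideanSpace_fin, abs_inv, abs_pow, abs_neg, abs_of_pos (by positivity)]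
  rw [h2] at h
  have h3 : opSchwartz a φ x = ((2 * Real.pi) ^ n)⁻¹ • ∫ ξ : Euc n,
      Complex.exp (Complex.I * (inner ℝ x ξ : ℝ)) * a x ξ * 𝓕 φ ((2 * Real.pi)⁻¹ • ξ) := by
    rw [opSchwartz, Complex.real_smul]
    push_cast
    rfl
  rw [h3, ← h, ampTransform, oscIntegral, Real.fourier_eq]
  congr 1
  ext ζ
  rw [SchwartzMap.fourierInv_coe, Real.fourierInv_eq_fourier_neg, Circle.smul_def,
    Real.fourierChar_apply, smul_smul, inner_smul_right, real_inner_comm]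
  have h4 : (2 * Real.pi)⁻¹ * -(2 * Real.pi) = -1 := by
    field_simp
  rw [h4, neg_one_smul, smul_eq_mul, mul_assoc, SchwartzMap.fourier_coe]
  congr 2
  push_cast
  ring

/-- The continuous extension of `OP(a)` to `𝓢'`. -/
noncomputable def opCLM (ha : IsAmplitude d fun p : Euc n × Euc n => a p.1 p.2) :
    𝓢'(Euc n, ℂ) →L[ℂ] 𝓢'(Euc n, ℂ) :=
  PointwiseConvergenceCLM.precomp ℂ
    ((fourierInvCLM ℂ 𝓢(Euc n, ℂ)).comp (ha.comp_smul (-(2 * Real.pi))).transformCLM)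

theorem opCLM_apply (ha : IsAmplitude d fun p : Euc n × Euc n => a p.1 p.2)
    (u : 𝓢'(Euc n, ℂ)) (ψ : 𝓢(Euc n, ℂ)) :
    opCLM ha u ψ = u (𝓕⁻ ((ha.comp_smul (-(2 * Real.pi))).transformCLM ψ)) := rfl

/-- For Schwartz `φ`, move `𝓕⁻` from the transform of `ψ` to `φ` and transpose the transform by
`integral_ampTransform_mul`; what pairs with `ψ` is then `OP(a)φ`. -/
theorem isOpExtension_opCLM (ha : IsAmplitude d fun p : Euc n × Euc n => a p.1 p.2) :
    IsOpExtension a (opCLM ha) := by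
  intro φ
  have hc := ha.comp_smul (-(2 * Real.pi))
  obtain ⟨f, hf⟩ := hc.exists_schwartz (𝓕⁻ φ)
  refine ⟨f, fun x => ?_, ?_⟩
  · rw [hf, opSchwartz_eq_ampTransform]
    rfl
  · ext ψ
    rw [opCLM_apply, SchwartzMap.coe_apply, SchwartzMap.coe_apply]
    simp only [smul_eq_mul]
    rw [SchwartzMap.integral_fourierInv_mul_eq]
    simp only [hf]
    exact hc.integral_ampTransform_mul ψ (𝓕⁻ φ)

theorem isOpExtension_pseudoDiff (ha : IsAmplitude d fun p : Euc n × Euc n => a p.1 p.2) :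
    IsOpExtension a (pseudoDiff a) := by
  have h : ∃ A, IsOpExtension a A := ⟨_, isOpExtension_opCLM ha⟩
  rw [pseudoDiff, dif_pos h]
  exact h.choose_spec

theorem pseudoDiff_apply (ha : IsAmplitude d fun p : Euc n × Euc n => a p.1 p.2)
    (u : 𝓢'(Euc n, ℂ)) (ψ : 𝓢(Euc n, ℂ)) :
    pseudoDiff a u ψ = u (𝓕⁻ ((ha.comp_smul (-(2 * Real.pi))).transformCLM ψ)) := by
  rw [(isOpExtension_pseudoDiff ha).unique (isOpExtension_opCLM ha), opCLM_apply]

theorem pseudoDiff_apply_of_transform (ha : IsAmplitude d fun p : Euc n × Euc n => a p.1 p.2)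
    (u : 𝓢'(Euc n, ℂ)) (ψ g : 𝓢(Euc n, ℂ))
    (hg : ∀ ζ, g ζ = ampTransform (fun p : Euc n × Euc n => a p.1 (-(2 * Real.pi) • p.2)) ψ ζ) :
    pseudoDiff a u ψ = u (𝓕⁻ g) := by
  rw [pseudoDiff_apply ha]
  congr 2
  ext ζ
  exact (hg ζ).symm

theorem pseudoDiff_add (ha : IsAmplitude d fun p : Euc n × Euc n => a p.1 p.2)
    (hb : IsAmplitude d fun p : Euc n × Euc n => b p.1 p.2)
    (hab : IsAmplitude d fun p : Euc n × Euc n => a p.1 p.2 + b p.1 p.2) (u : 𝓢'(Euc n, ℂ)) :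
    pseudoDiff (fun x ξ => a x ξ + b x ξ) u = pseudoDiff a u + pseudoDiff b u := by
  have ha' := ha.comp_smul (-(2 * Real.pi))
  have hb' := hb.comp_smul (-(2 * Real.pi))
  ext ψ
  rw [pseudoDiff_apply_of_transform (a := fun x ξ => a x ξ + b x ξ) hab u ψ
    (ha'.transformCLM ψ + hb'.transformCLM ψ) fun ζ => ?_]
  · rw [FourierTransform.fourierInv_add, map_add]
    exact congrArg₂ _ (pseudoDiff_apply ha u ψ).symm (pseudoDiff_apply hb u ψ).symm
  · rw [add_apply, ha'.transformCLM_apply, hb'.transformCLM_apply]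
    simp only [ampTransform, oscIntegral, Real.fourier_eq]
    rw [← integral_add ((Real.fourierIntegral_convergent_iff ζ).2 (ha'.integrable ψ ζ))
      ((Real.fourierIntegral_convergent_iff ζ).2 (hb'.integrable ψ ζ))]
    congr 1
    ext x
    simp only [← smul_add, ← add_mul]

/-- Dually, both sides multiply the transform of `ψ` by `m`. Evenness of `m` absorbs the two
reflections, one from applying `𝓕⁻` twice and one from `ξ = -2πζ`. -/
theorem pseudoDiff_fourierMultiplier {d' : ℕ} {m : Euc n → ℂ}
    (ha : IsAmplitude d fun p : Euc n × Euc n => a p.1 p.2)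
    (ham : IsAmplitude d' fun p : Euc n × Euc n => a p.1 p.2 * m p.2)
    (hm : (fun ζ => m ((2 * Real.pi) • ζ)).HasTemperateGrowth) (hm' : ∀ ξ, m (-ξ) = m ξ)
    (u : 𝓢'(Euc n, ℂ)) :
    pseudoDiff a (TemperedDistribution.fourierMultiplierCLM ℂ
      (fun ζ => m ((2 * Real.pi) • ζ)) u) = pseudoDiff (fun x ξ => a x ξ * m ξ) u := by
  ext ψ
  have ha' := ha.comp_smul (-(2 * Real.pi))
  rw [pseudoDiff_apply ha, TemperedDistribution.fourierMultiplierCLM_apply_apply,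
    pseudoDiff_apply_of_transform (a := fun x ξ => a x ξ * m ξ) ham u ψ
      (SchwartzMap.smulLeftCLM ℂ (fun ζ => m ((2 * Real.pi) • ζ)) (ha'.transformCLM ψ)) fun ζ => ?_]
  · congr 1
    ext x
    rw [SchwartzMap.fourierInv_coe (SchwartzMap.smulLeftCLM ℂ _ _),
      Real.fourierInv_eq_fourier_comp_neg, SchwartzMap.fourier_coe]
    refine congrFun (congrArg 𝓕 (funext fun ζ => ?_)) x
    rw [SchwartzMap.smulLeftCLM_apply_apply hm, SchwartzMap.fourierInv_coe (𝓕⁻ _),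
      Real.fourierInv_eq_fourier_neg, ← SchwartzMap.fourier_coe,
      FourierTransform.fourier_fourierInv_eq, SchwartzMap.smulLeftCLM_apply_apply hm, smul_neg, hm']
  · rw [SchwartzMap.smulLeftCLM_apply_apply hm, ha'.transformCLM_apply, smul_eq_mul]
    simp only [ampTransform, oscIntegral, Real.fourier_eq]
    rw [← integral_const_mul]
    congr 1
    ext x
    rw [neg_smul, hm']
    simp only [Circle.smul_def, smul_eq_mul]
    ring

/-- The continuity estimate of pseudo-differential operators, uniform in the amplitude. -/
theorem exists_norm_pseudoDiff_apply_le (u : 𝓢'(Euc n, ℂ)) (d : ℕ) :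
    ∃ K : ℕ, ∃ s : Finset (ℕ × ℕ), ∃ C : ℝ, 0 ≤ C ∧
      ∀ {R : ℝ} {a : Euc n → Euc n → ℂ}, 0 ≤ R →
      IsAmplitude d (fun p : Euc n × Euc n => a p.1 p.2) →
      DerivBound K (fun p : Euc n × Euc n => R * (1 + ‖p.2‖) ^ d)
        (fun p : Euc n × Euc n => a p.1 p.2) →
      ∀ ψ : 𝓢(Euc n, ℂ), ‖pseudoDiff a u ψ‖ ≤
        R * (C * s.sup (schwartzSeminormFamily ℂ (Euc n) ℂ) ψ) := by
  let q : Seminorm ℂ 𝓢(Euc n, ℂ) :=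
    (normSeminorm ℂ ℂ).comp (u.toLinearMap.comp (fourierInvCLM ℂ 𝓢(Euc n, ℂ)).toLinearMap)
  have hq : Continuous q :=
    continuous_norm.comp (u.continuous.comp (fourierInvCLM ℂ 𝓢(Euc n, ℂ)).continuous)
  obtain ⟨s, C, -, hC⟩ := Seminorm.bound_of_continuous (schwartz_withSeminorms ℂ (Euc n) ℂ) q hq
  -- Continuity of `ψ ↦ u (𝓕⁻ ψ)` involves only the finitely many seminorms in `s`, so it suffices
  -- to combine the orders and constants belonging to `m ∈ s`.
  choose K M B hB h using fun m : ℕ × ℕ => exists_decay_ampTransform (V := Euc n) m.1 m.2 d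
  refine ⟨s.sup K, s.biUnion fun m => Finset.Iic (M m, K m),
    C * (∑ m ∈ s, B m) * max 1 |(-(2 * Real.pi))| ^ (s.sup K + d),
    mul_nonneg (mul_nonneg C.2 (Finset.sum_nonneg fun m _ => hB m)) (by positivity),
    fun {R a} hR ha hb ψ => ?_⟩
  have hc := ha.comp_smul (-(2 * Real.pi))
  have hcb := hb.comp_smul hR ha.1 (-(2 * Real.pi))
  rw [pseudoDiff_apply ha]
  refine (hC (hc.transformCLM ψ)).trans ?_
  rw [smul_apply, NNReal.smul_def, smul_eq_mul]
  have key : s.sup (schwartzSeminormFamily ℂ (Euc n) ℂ) (hc.transformCLM ψ) ≤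
      (∑ m ∈ s, B m) * (max 1 |(-(2 * Real.pi))| ^ (s.sup K + d) * R) *
        (s.biUnion fun m => Finset.Iic (M m, K m)).sup (schwartzSeminormFamily ℂ (Euc n) ℂ) ψ := by
    have hS : 0 ≤ ∑ m ∈ s, B m := Finset.sum_nonneg fun m _ => hB m
    refine Seminorm.finset_sup_apply_le (by positivity) fun m hm => ?_
    refine SchwartzMap.seminorm_le_bound ℂ m.1 m.2 _ (by positivity) fun ζ => ?_
    refine (h m (by positivity) hc.1 (hcb.mono (Finset.le_sup hm) fun _ => le_rfl) ψ ζ).trans ?_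
    gcongr
    · exact Finset.single_le_sum (fun m _ => hB m) hm
    · have : (Finset.Iic (M m, K m)) ⊆ s.biUnion fun m => Finset.Iic (M m, K m) :=
        Finset.subset_biUnion_of_mem (fun m => Finset.Iic (M m, K m)) hm
      exact Seminorm.le_def.1 (Finset.sup_mono this) ψ
  calc (C : ℝ) * _ ≤ C * _ := mul_le_mul_of_nonneg_left key C.2
    _ = _ := by ring

end Operators

/-! ### Averaging amplitudes in the space variable -/

section Averages

variable {V F : Type} [NormedAddCommGroup V] [InnerProductSpace ℝ V]
  [NormedAddCommGroup F] [NormedSpace ℂ F]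

theorem norm_smul_translate_le {κ : 𝓢(V, ℂ)} {t : ℝ} {d : ℕ} {R : ℝ} {c : V × V → F}
    (hb : ∀ p : V × V, ‖c p‖ ≤ R * (1 + ‖p.2‖) ^ d) (p : V × V) (z : V) :
    ‖κ z • c (p.1 - t • z, p.2)‖ ≤ ‖κ z‖ * (R * (1 + ‖p.2‖) ^ d) := by
  rw [norm_smul]
  exact mul_le_mul_of_nonneg_left (hb (p.1 - t • z, p.2)) (norm_nonneg _)

variable [FiniteDimensional ℝ V] [MeasurableSpace V] [BorelSpace V]

/-- The weighted average `∫ κ(z) c(x - t z, ξ) dz` in the first variable. -/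
noncomputable def fstAverage (κ : 𝓢(V, ℂ)) (t : ℝ) (c : V × V → F) (p : V × V) : F :=
  ∫ z, κ z • c (p.1 - t • z, p.2)

variable {κ : 𝓢(V, ℂ)} {t : ℝ} {d : ℕ} {R : ℝ}

theorem integrable_fstAverage {c : V × V → F} (hc : Continuous c)
    (hb : ∀ p : V × V, ‖c p‖ ≤ R * (1 + ‖p.2‖) ^ d) (p : V × V) :
    Integrable fun z => κ z • c (p.1 - t • z, p.2) := by
  refine (κ.integrable.norm.mul_const (R * (1 + ‖p.2‖) ^ d)).mono' ?_
    (Eventually.of_forall (norm_smul_translate_le hb p))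
  exact (κ.continuous.smul (hc.comp (by fun_prop))).aestronglyMeasurable

theorem norm_fstAverage_le {c : V × V → F}
    (hb : ∀ p : V × V, ‖c p‖ ≤ R * (1 + ‖p.2‖) ^ d) (p : V × V) :
    ‖fstAverage κ t c p‖ ≤ (∫ z, ‖κ z‖) * R * (1 + ‖p.2‖) ^ d := by
  refine (norm_integral_le_of_norm_le (κ.integrable.norm.mul_const (R * (1 + ‖p.2‖) ^ d))
    (Eventually.of_forall (norm_smul_translate_le hb p))).trans_eq ?_
  rw [integral_mul_const, mul_assoc]

theorem hasFDerivAt_fstAverage {c : V × V → F} (hR : 0 ≤ R) (hc : ContDiff ℝ (⊤ : ℕ∞) c)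
    (hb : DerivBound 1 (fun p : V × V => R * (1 + ‖p.2‖) ^ d) c) (p : V × V) :
    HasFDerivAt (fstAverage κ t c) (fstAverage κ t (fderiv ℝ c) p) p := by
  have h1 : Continuous (fderiv ℝ c) := hc.continuous_fderiv (by simp)
  have hb' := hb.fderiv.norm_le
  refine hasFDerivAt_integral_of_dominated_of_fderiv_le (𝕜 := ℝ) (μ := (volume : Measure V))
    (F := fun (p : V × V) z => κ z • c (p.1 - t • z, p.2))
    (F' := fun (p : V × V) z => κ z • fderiv ℝ c (p.1 - t • z, p.2))
    (bound := fun z => ‖κ z‖ * (R * (2 + ‖p.2‖) ^ d))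
    (Metric.ball_mem_nhds p one_pos)
    (Eventually.of_forall fun q => (integrable_fstAverage hc.continuous hb.norm_le q).1)
    (integrable_fstAverage hc.continuous hb.norm_le p)
    (integrable_fstAverage h1 hb' p).1
    (Eventually.of_forall fun z q hq => ?_)
    (κ.integrable.norm.mul_const _)
    (Eventually.of_forall fun z q _ => ?_)
  · have h2 : ‖q.2‖ ≤ 1 + ‖p.2‖ := by
      have h3 := norm_le_norm_add_norm_sub' q.2 p.2
      have h4 := mem_ball_iff_norm.1 hq
      have h5 := norm_snd_le (q - p)
      rw [Prod.snd_sub] at h5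
      linarith
    have h6 : 1 + ‖q.2‖ ≤ 2 + ‖p.2‖ := by linarith
    refine (norm_smul_translate_le hb' q z).trans
      (mul_le_mul_of_nonneg_left ?_ (norm_nonneg _))
    exact mul_le_mul_of_nonneg_left (pow_le_pow_left₀ (by positivity) h6 d) hR
  · have h2 : HasFDerivAt (fun q : V × V => q - (t • z, 0)) (ContinuousLinearMap.id ℝ _) q :=
      (hasFDerivAt_id q).sub_const _
    have h3 : (q - (t • z, 0)) = (q.1 - t • z, q.2) := by ext <;> simp
    have h4 : HasFDerivAt c (fderiv ℝ c (q.1 - t • z, q.2)) (q - (t • z, 0)) := by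
      rw [h3]
      exact ((hc.differentiable (by simp)).differentiableAt).hasFDerivAt
    have h5 := (HasFDerivAt.comp q h4 h2).const_smul (κ z)
    rw [ContinuousLinearMap.comp_id] at h5
    refine h5.congr_of_eventuallyEq (Eventually.of_forall fun q => ?_)
    refine congrArg (fun r => κ z • c r) ?_
    ext <;> simp

theorem fderiv_fstAverage {c : V × V → F} (hR : 0 ≤ R) (hc : ContDiff ℝ (⊤ : ℕ∞) c)
    (hb : DerivBound 1 (fun p : V × V => R * (1 + ‖p.2‖) ^ d) c) :
    fderiv ℝ (fstAverage κ t c) = fstAverage κ t (fderiv ℝ c) :=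
  funext fun p => (hasFDerivAt_fstAverage hR hc hb p).fderiv

/-- Averaging commutes with differentiation, so the sup bound applies to every derivative; hence the
induction over the target space `F`. -/
theorem DerivBound.fstAverage {K : ℕ} {c : V × V → F} (hR : 0 ≤ R)
    (hc : ContDiff ℝ (⊤ : ℕ∞) c)
    (hb : DerivBound K (fun p : V × V => R * (1 + ‖p.2‖) ^ d) c) :
    DerivBound K (fun p : V × V => (∫ z, ‖κ z‖) * R * (1 + ‖p.2‖) ^ d) (fstAverage κ t c) := by
  intro k hk p
  replace hb := hb.mono hk fun _ => le_rfl
  clear hk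
  induction k generalizing F with
  | zero =>
    rw [norm_iteratedFDeriv_zero]
    exact norm_fstAverage_le hb.norm_le p
  | succ k ih =>
    rw [← norm_iteratedFDeriv_fderiv,
      fderiv_fstAverage hR hc (hb.mono (by omega) fun _ => le_rfl)]
    exact ih (hc.fderiv_right le_rfl) hb.fderiv

theorem contDiff_fstAverage {c : V × V → F} (hc : ContDiff ℝ (⊤ : ℕ∞) c)
    (hb : ∀ K, ∃ C, 0 ≤ C ∧ DerivBound K (fun p : V × V => C * (1 + ‖p.2‖) ^ d) c) :
    ContDiff ℝ (⊤ : ℕ∞) (fstAverage κ t c) := by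
  refine contDiff_infty.2 fun N => ?_
  induction N generalizing F with
  | zero =>
    obtain ⟨C, hC, h⟩ := hb 1
    exact contDiff_zero.2 (continuous_iff_continuousAt.2 fun p =>
      (hasFDerivAt_fstAverage hC hc h p).continuousAt)
  | succ N ih =>
    obtain ⟨C, hC, h⟩ := hb 1
    push_cast
    rw [contDiff_succ_iff_fderiv]
    refine ⟨fun p => (hasFDerivAt_fstAverage hC hc h p).differentiableAt, by simp, ?_⟩
    rw [fderiv_fstAverage hC hc h]
    refine ih (hc.fderiv_right le_rfl) fun K => ?_
    obtain ⟨C, hC, h⟩ := hb (K + 1)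
    exact ⟨C, hC, h.fderiv⟩

theorem IsAmplitude.fstAverage {c : V × V → ℂ} (hc : IsAmplitude d c) (κ : 𝓢(V, ℂ)) (t : ℝ) :
    IsAmplitude d (fstAverage κ t c) := by
  refine ⟨contDiff_fstAverage hc.1 hc.2, fun K => ?_⟩
  obtain ⟨C, hC, h⟩ := hc.2 K
  exact ⟨_, mul_nonneg (integral_nonneg fun _ => norm_nonneg _) hC, h.fstAverage hC hc.1⟩

variable [CompleteSpace F]

/-- Since `κ` has mass one, the difference averages `c(x - t z, ξ) - c(x, ξ)`, which the mean value
inequality bounds by `|t| ‖z‖` times the `x`-derivative. The first absolute moment of `κ` is finite.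
-/
theorem norm_fstAverage_sub_le {c : V × V → F} (hκ : ∫ z, κ z = 1)
    (hc : ContDiff ℝ (⊤ : ℕ∞) c)
    (hb : DerivBound 1 (fun p : V × V => R * (1 + ‖p.2‖) ^ d) c) (p : V × V) :
    ‖fstAverage κ t c p - c p‖ ≤
      (∫ z, ‖z‖ * ‖κ z‖) * (|t| * R) * (1 + ‖p.2‖) ^ d := by
  have h0 : fstAverage κ t c p - c p = ∫ z, κ z • (c (p.1 - t • z, p.2) - c p) := by
    simp only [smul_sub]
    rw [integral_sub (integrable_fstAverage hc.continuous hb.norm_le p)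
      (κ.integrable.smul_const _), integral_smul_const, hκ, one_smul]
    rfl
  have h1 : ∀ z : V, ‖c (p.1 - t • z, p.2) - c p‖ ≤ R * (1 + ‖p.2‖) ^ d * (|t| * ‖z‖) := by
    intro z
    have h2 : ∀ x ∈ Set.univ, HasFDerivWithinAt (fun x => c (x, p.2))
        ((fderiv ℝ c (x, p.2)).comp (ContinuousLinearMap.inl ℝ V V)) Set.univ x := fun x _ =>
      (HasFDerivAt.comp (f := fun x => (x, p.2)) x
        ((hc.differentiable (by simp)).differentiableAt (x := (x, p.2))).hasFDerivAt
        (hasFDerivAt_prodMk_left x p.2)).hasFDerivWithinAt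
    have h3 := convex_univ.norm_image_sub_le_of_norm_hasFDerivWithin_le
      (C := R * (1 + ‖p.2‖) ^ d) h2 (fun x _ => ?_) (Set.mem_univ p.1) (Set.mem_univ (p.1 - t • z))
    · rwa [sub_sub_cancel_left, norm_neg, norm_smul, Real.norm_eq_abs] at h3
    · refine ((ContinuousLinearMap.opNorm_comp_le _ _).trans ?_).trans (hb.fderiv.norm_le (x, p.2))
      exact mul_le_of_le_one_right (norm_nonneg _) (ContinuousLinearMap.norm_inl_le_one ℝ V V)
  rw [h0]
  have h4 : Integrable fun z => ‖z‖ * ‖κ z‖ := by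
    simpa using κ.integrable_pow_mul volume 1
  refine (norm_integral_le_of_norm_le (h4.mul_const ((|t| * R) * (1 + ‖p.2‖) ^ d))
    (Eventually.of_forall fun z => ?_)).trans_eq ?_
  · rw [norm_smul]
    refine (mul_le_mul_of_nonneg_left (h1 z) (norm_nonneg _)).trans_eq ?_
    ring
  · rw [integral_mul_const]
    ring

theorem DerivBound.fstAverage_sub {K : ℕ} {c : V × V → F} (hκ : ∫ z, κ z = 1) (hR : 0 ≤ R)
    (hc : ContDiff ℝ (⊤ : ℕ∞) c)
    (hb : DerivBound (K + 1) (fun p : V × V => R * (1 + ‖p.2‖) ^ d) c) :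
    DerivBound K (fun p : V × V => (∫ z, ‖z‖ * ‖κ z‖) * (|t| * R) * (1 + ‖p.2‖) ^ d)
      (fun p => _root_.fstAverage κ t c p - c p) := by
  intro k hk p
  replace hb := hb.mono (Nat.succ_le_succ hk) fun _ => le_rfl
  clear hk
  induction k generalizing F with
  | zero =>
    rw [norm_iteratedFDeriv_zero]
    exact norm_fstAverage_sub_le hκ hc hb p
  | succ k ih =>
    have h1 := hb.mono (show 1 ≤ k + 1 + 1 by omega) fun _ => le_rfl
    have h2 : _root_.fderiv ℝ (fun p => _root_.fstAverage κ t c p - c p) =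
        fun p => _root_.fstAverage κ t (_root_.fderiv ℝ c) p - _root_.fderiv ℝ c p :=
      funext fun p => ((hasFDerivAt_fstAverage hR hc h1 p).sub
        ((hc.differentiable (by simp)).differentiableAt (x := p)).hasFDerivAt).fderiv
    rw [← norm_iteratedFDeriv_fderiv, h2]
    exact ih (hc.fderiv_right le_rfl) hb.fderiv

end Averages

/-! ### Fourier multipliers as convolutions -/

section Multipliers

variable {n : ℕ}

/-- Substitution `y = t z`: dilating the multiplier contracts the kernel. With `t = 2^{-j}`,
`Ψ_j(D_x)` becomes an average over distances of order `2^{-j}` with a kernel independent of `j`. -/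
theorem multiplierConv_comp_smul (m : Euc n → ℂ) (f : Euc n → ℂ) {t : ℝ} (ht : 0 < t)
    (x : Euc n) :
    multiplierConv (fun ζ => m (t • ζ)) f x = ∫ z, 𝓕⁻ m z * f (x - t • z) := by
  have h1 : ∀ z, 𝓕⁻ (fun ζ => m (t • ζ)) (t • z) =
      |(t ^ Module.finrank ℝ (Euc n))⁻¹| • 𝓕⁻ m z := fun z => by
    rw [Real.fourierInv_eq, Real.fourierInv_eq, ← Measure.integral_comp_smul]
    congr 1
    ext ζ
    rw [inner_smul_left, inner_smul_right]
    rfl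
  have h2 := Measure.integral_comp_smul (volume : Measure (Euc n))
    (fun y => 𝓕⁻ (fun ζ => m (t • ζ)) y * f (x - y)) t
  simp only [h1, smul_mul_assoc] at h2
  rw [integral_smul] at h2
  have h3 : |(t ^ Module.finrank ℝ (Euc n))⁻¹| ≠ 0 := by positivity
  exact (smul_right_injective ℂ h3 h2).symm

theorem multiplierConv_sub (m₁ m₂ : 𝓢(Euc n, ℂ)) {f : Euc n → ℂ} (hf : Continuous f) {C : ℝ}
    (hC : ∀ x, ‖f x‖ ≤ C) (x : Euc n) :
    multiplierConv (fun ζ => m₁ ζ - m₂ ζ) f x = multiplierConv m₁ f x - multiplierConv m₂ f x := by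
  have hi : ∀ m : 𝓢(Euc n, ℂ), Integrable fun y => 𝓕⁻ (m : Euc n → ℂ) y * f (x - y) := fun m => by
    rw [← SchwartzMap.fourierInv_coe]
    exact (𝓕⁻ m).integrable.mul_bdd (c := C)
      (hf.comp (by fun_prop)).aestronglyMeasurable (Eventually.of_forall fun y => hC _)
  rw [multiplierConv, multiplierConv, multiplierConv, ← integral_sub (hi m₁) (hi m₂)]
  congr 1
  ext y
  rw [← sub_mul]
  congr 1
  change 𝓕⁻ (⇑(m₁ - m₂)) y = _
  rw [← SchwartzMap.fourierInv_coe, ← SchwartzMap.fourierInv_coe, ← SchwartzMap.fourierInv_coe]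
  exact congrArg (fun g : 𝓢(Euc n, ℂ) => g y) ((fourierInvCLM ℂ 𝓢(Euc n, ℂ)).map_sub m₁ m₂)

end Multipliers

/-! ### Littlewood-Paley cut-offs -/

section Cutoffs

variable {n : ℕ} {Ψ : ℝ → ℝ}

theorem lpPsi_of_neg {j : ℤ} (hj : j < 0) (ξ : Euc n) : lpPsi Ψ j ξ = 0 :=
  if_neg (by omega)

theorem lpPsi_natCast (j : ℕ) (ξ : Euc n) :
    lpPsi Ψ (j : ℤ) ξ = (Ψ ‖((2 : ℝ)⁻¹ ^ j) • ξ‖ : ℂ) := by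
  rw [lpPsi, if_pos (by omega), norm_smul, Real.norm_of_nonneg (by positivity), zpow_neg,
    zpow_natCast, inv_pow]

theorem lpPsi_neg (j : ℤ) (ξ : Euc n) : lpPsi Ψ j (-ξ) = lpPsi Ψ j ξ := by
  simp only [lpPsi, norm_neg]

theorem contDiff_cutoff_norm (hΨ : IsLPCutoff Ψ) :
    ContDiff ℝ (⊤ : ℕ∞) (fun ξ : Euc n => (Ψ ‖ξ‖ : ℂ)) := by
  refine Complex.ofRealCLM.contDiff.comp (contDiff_iff_contDiffAt.2 fun ξ => ?_)
  -- The norm is not smooth at the origin, but the cut-off is constant near it.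
  by_cases hξ : ξ = 0
  · refine (contDiffAt_const (c := (1 : ℝ))).congr_of_eventuallyEq ?_
    filter_upwards [Metric.ball_mem_nhds ξ one_pos] with η hη
    rw [hξ, mem_ball_zero_iff] at hη
    exact hΨ.eq_one _ (by linarith)
  · exact hΨ.smooth.contDiffAt.comp ξ (contDiffAt_norm ℝ hξ)

theorem hasCompactSupport_cutoff_norm (hΨ : IsLPCutoff Ψ) :
    HasCompactSupport (fun ξ : Euc n => (Ψ ‖ξ‖ : ℂ)) := by
  refine HasCompactSupport.of_support_subset_isCompact
    (isCompact_closedBall (0 : Euc n) (13 / 10)) fun ξ hξ => ?_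
  rw [mem_closedBall_zero_iff]
  by_contra h
  exact hξ (by simp [hΨ.eq_zero _ (not_le.1 h).le])

/-- The cut-off `ξ ↦ Ψ(|ξ|)` as a Schwartz function. -/
noncomputable def cutoff (n : ℕ) (hΨ : IsLPCutoff Ψ) : 𝓢(Euc n, ℂ) :=
  (hasCompactSupport_cutoff_norm hΨ).toSchwartzMap (contDiff_cutoff_norm hΨ)

theorem cutoff_apply (hΨ : IsLPCutoff Ψ) (ξ : Euc n) : cutoff n hΨ ξ = (Ψ ‖ξ‖ : ℂ) := rfl

/-- Dilation of Schwartz functions. -/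
noncomputable def dilation (φ : 𝓢(Euc n, ℂ)) (t : ℝ) (ht : t ≠ 0) : 𝓢(Euc n, ℂ) :=
  SchwartzMap.compCLMOfContinuousLinearEquiv ℂ
    (ContinuousLinearEquiv.smulLeft (Units.mk0 t ht)) φ

theorem dilation_apply (φ : 𝓢(Euc n, ℂ)) (t : ℝ) (ht : t ≠ 0) (ξ : Euc n) :
    dilation φ t ht ξ = φ (t • ξ) := rfl

/-- `lpPsi Ψ j` in the frequency variable of `𝓕`, as a Schwartz function. -/
noncomputable def cutoffMultiplier (n : ℕ) (hΨ : IsLPCutoff Ψ) (j : ℤ) : 𝓢(Euc n, ℂ) :=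
  if 0 ≤ j then
    dilation (cutoff n hΨ) ((2 : ℝ) ^ (-j) * (2 * Real.pi)) (by positivity)
  else 0

theorem cutoffMultiplier_apply (hΨ : IsLPCutoff Ψ) (j : ℤ) (ζ : Euc n) :
    cutoffMultiplier n hΨ j ζ = lpPsi Ψ j ((2 * Real.pi) • ζ) := by
  unfold cutoffMultiplier lpPsi
  split_ifs with h
  · rw [dilation_apply, cutoff_apply, mul_smul, norm_smul, Real.norm_of_nonneg (by positivity)]
  · rfl

theorem cutoffMultiplier_natCast (hΨ : IsLPCutoff Ψ) (j : ℕ) (ζ : Euc n) :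
    cutoffMultiplier n hΨ (j : ℤ) ζ = cutoffMultiplier n hΨ 0 ((2 : ℝ)⁻¹ ^ j • ζ) := by
  rw [cutoffMultiplier_apply, cutoffMultiplier_apply, lpPsi_natCast,
    show (0 : ℤ) = ((0 : ℕ) : ℤ) from rfl, lpPsi_natCast, pow_zero, one_smul, smul_comm]

theorem contDiff_lpPsi (hΨ : IsLPCutoff Ψ) (j : ℤ) :
    ContDiff ℝ (⊤ : ℕ∞) (lpPsi (n := n) Ψ j) := by
  rcases lt_or_ge j 0 with hj | hj
  · rw [show lpPsi (n := n) Ψ j = fun _ => 0 from funext (lpPsi_of_neg hj)]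
    exact contDiff_const
  · lift j to ℕ using hj
    rw [show lpPsi (n := n) Ψ j = fun ξ => (Ψ ‖((2 : ℝ)⁻¹ ^ j) • ξ‖ : ℂ) from
      funext (lpPsi_natCast j)]
    exact (contDiff_cutoff_norm hΨ).comp (contDiff_const_smul _)

/-- All derivatives of `Ψ_j` are bounded uniformly in `j`. -/
theorem exists_derivBound_lpPsi (n : ℕ) (hΨ : IsLPCutoff Ψ) (K : ℕ) :
    ∃ C, 0 ≤ C ∧ ∀ j : ℤ, DerivBound K (fun _ => C) (lpPsi (n := n) Ψ j) := by
  refine ⟨2 ^ 0 * (Finset.Iic (0, K)).sup (schwartzSeminormFamily ℂ (Euc n) ℂ) (cutoff n hΨ),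
    by positivity, fun j => ?_⟩
  rcases lt_or_ge j 0 with hj | hj
  · rw [show lpPsi (n := n) Ψ j = fun _ => 0 from funext (lpPsi_of_neg hj)]
    intro k _ p
    rw [iteratedFDeriv_fun_zero]
    simp only [Pi.zero_apply, norm_zero]
    positivity
  · lift j to ℕ using hj
    rw [show lpPsi (n := n) Ψ j = fun ξ => cutoff n hΨ (((2 : ℝ)⁻¹ ^ j) • ξ) from
      funext (lpPsi_natCast j)]
    refine ((derivBound_schwartz K 0 (cutoff n hΨ)).comp_clm
      (((2 : ℝ)⁻¹ ^ j) • ContinuousLinearMap.id ℝ (Euc n)) ((cutoff n hΨ).smooth _)).mono le_rfl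
      fun ξ => ?_
    -- The dilation by `2^{-j}` is a contraction, so the chain rule costs nothing and the bound is
    -- uniform in `j`.
    rw [max_eq_left, one_pow, one_mul, pow_zero, pow_zero, inv_one, mul_one]
    refine ContinuousLinearMap.opNorm_le_bound _ zero_le_one fun ξ => ?_
    change ‖(2 : ℝ)⁻¹ ^ j • ξ‖ ≤ _
    rw [norm_smul, Real.norm_of_nonneg (by positivity)]
    gcongr
    exact pow_le_one₀ (by norm_num) (by norm_num)

theorem lpPsi_eq_one (hΨ : IsLPCutoff Ψ) (j : ℕ) {ξ : Euc n} (hξ : ‖ξ‖ ≤ 11 / 10 * 2 ^ j) :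
    lpPsi Ψ j ξ = 1 := by
  rw [lpPsi_natCast, hΨ.eq_one, Complex.ofReal_one]
  rw [norm_smul, Real.norm_of_nonneg (by positivity), inv_pow, inv_mul_le_iff₀ (by positivity)]
  linarith

theorem lpPsi_eq_zero (hΨ : IsLPCutoff Ψ) (j : ℕ) {ξ : Euc n} (hξ : 13 / 10 * 2 ^ j ≤ ‖ξ‖) :
    lpPsi Ψ j ξ = 0 := by
  rw [lpPsi_natCast, hΨ.eq_zero, Complex.ofReal_zero]
  rw [norm_smul, Real.norm_of_nonneg (by positivity), inv_pow, le_inv_mul_iff₀ (by positivity)]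
  linarith

/-- `Ψ_j - 1` is small of order `2^{-j}` as a symbol of order one. -/
theorem exists_derivBound_lpPsi_sub_one (n : ℕ) (hΨ : IsLPCutoff Ψ) (K : ℕ) :
    ∃ C, 0 ≤ C ∧ ∀ j : ℕ, DerivBound K (fun ξ => C * 2⁻¹ ^ j * (1 + ‖ξ‖))
      (fun ξ : Euc n => lpPsi Ψ j ξ - 1) := by
  obtain ⟨C, hC, h⟩ := exists_derivBound_lpPsi n hΨ K
  refine ⟨C + 1, by positivity, fun j k hk ξ => ?_⟩
  -- Inside this ball `Ψ_j - 1` vanishes identically. Outside, `1 ≤ 2^{-j} (1 + ‖ξ‖)`, so the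
  -- uniform bound suffices.
  rcases lt_or_ge ‖ξ‖ (2 ^ j) with hξ | hξ
  · have h1 : (fun ξ : Euc n => lpPsi Ψ j ξ - 1) =ᶠ[𝓝 ξ] 0 := by
      filter_upwards [(isOpen_lt continuous_norm continuous_const).mem_nhds hξ] with η hη
      rw [lpPsi_eq_one hΨ j, sub_self]
      · rfl
      · have : ‖η‖ < 2 ^ j := hη
        linarith [pow_pos (two_pos : (0 : ℝ) < 2) j]
    rw [(h1.iteratedFDeriv ℝ k).eq_of_nhds, show (0 : Euc n → ℂ) = fun _ => 0 from rfl,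
      iteratedFDeriv_fun_zero]
    simp only [Pi.zero_apply, norm_zero]
    positivity
  · have h2 : DerivBound K (fun _ => (1 : ℝ)) (fun _ : Euc n => (-1 : ℂ)) := fun k _ p => by
      rcases k with _ | k
      · simp
      · rw [iteratedFDeriv_const_of_ne (by omega)]
        simp
    have h3 := (h j).add h2 (contDiff_lpPsi hΨ j) contDiff_const
    simp only [← sub_eq_add_neg] at h3
    refine (h3 k hk ξ).trans ?_
    dsimp only
    rw [mul_assoc]
    refine le_mul_of_one_le_right (by positivity) ?_
    rw [inv_pow, ← div_eq_inv_mul, one_le_div (by positivity)]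
    linarith

/-- The sum telescopes to `Φ̃_k = Ψ_{k+1} - Ψ_{k-2}`. For `k ≥ 1`, `Φ_k` vanishes unless `(11/20)
2^k ≤ |ξ| ≤ (13/10) 2^k`; there `Ψ_{k+1} = 1`, as `13/10 < 11/5`, and `Ψ_{k-2} = 0`, as `13/40 <
11/20`. -/
theorem lpPhiTilde_mul_lpPhi (hΨ : IsLPCutoff Ψ) (k : ℤ) (ξ : Euc n) :
    lpPhiTilde Ψ k ξ * lpPhi Ψ k ξ = lpPhi Ψ k ξ := by
  have e : lpPhiTilde Ψ k ξ = lpPsi Ψ (k + 1) ξ - lpPsi Ψ (k - 2) ξ := by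
    unfold lpPhiTilde lpPhi
    rw [show k + 1 - 1 = k by ring, show k - 1 - 1 = k - 2 by ring]
    ring
  rw [e]
  rcases lt_or_ge k 0 with hk | hk
  · rw [lpPhi, lpPsi_of_neg hk, lpPsi_of_neg (by omega : k - 1 < 0)]
    simp
  lift k to ℕ using hk
  rcases lt_or_ge ‖ξ‖ (11 / 10 * 2 ^ (k + 1)) with h1 | h1
  · rw [show (k : ℤ) + 1 = ((k + 1 : ℕ) : ℤ) by push_cast; ring, lpPsi_eq_one hΨ (k + 1) h1.le]
    -- For `k = 0, 1` the index `k - 2` is negative and `Ψ_{k-2} = 0` by convention.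
    rcases k with _ | _ | k
    · rw [lpPsi_of_neg (by simp)]
      ring
    · rw [lpPsi_of_neg (by simp)]
      ring
    · rw [show ((k + 1 + 1 : ℕ) : ℤ) - 2 = (k : ℤ) by push_cast; ring]
      rcases le_total (13 / 10 * 2 ^ k) ‖ξ‖ with h2 | h2
      · rw [lpPsi_eq_zero hΨ k h2]
        ring
      · have hp : (0 : ℝ) < 2 ^ k := by positivity
        have h3 : lpPhi Ψ ((k + 1 + 1 : ℕ) : ℤ) ξ = 0 := by
          rw [lpPhi, show ((k + 1 + 1 : ℕ) : ℤ) - 1 = ((k + 1 : ℕ) : ℤ) by push_cast; ring,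
            lpPsi_eq_one hΨ (k + 1 + 1), lpPsi_eq_one hΨ (k + 1), sub_self]
          · rw [pow_succ]; linarith
          · rw [pow_succ, pow_succ]; linarith
        rw [h3, mul_zero]
  · have hp : (0 : ℝ) < 2 ^ k := by positivity
    have h3 : lpPhi Ψ (k : ℤ) ξ = 0 := by
      rw [pow_succ] at h1
      rw [lpPhi, lpPsi_eq_zero hΨ k (by linarith)]
      rcases k with _ | k
      · rw [lpPsi_of_neg (by simp), sub_self]
      · rw [show ((k + 1 : ℕ) : ℤ) - 1 = (k : ℤ) by push_cast; ring, lpPsi_eq_zero hΨ k, sub_self]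
        rw [pow_succ] at h1 hp
        linarith
    rw [h3, mul_zero]

end Cutoffs

/-- The gain of one order per `ξ`-derivative is discarded and the real order rounded up to a natural
number. -/
theorem IsSymbolOneZero.exists_isAmplitude {n : ℕ} {a : Euc n → Euc n → ℂ}
    (ha : IsSymbolOneZero a) :
    ∃ d : ℕ, IsAmplitude d fun p : Euc n × Euc n => a p.1 p.2 := by
  obtain ⟨r, hs, hb⟩ := ha
  refine ⟨⌈r⌉₊, hs, fun K => ?_⟩
  have h1 : ∀ k, ∃ C : ℝ, ∀ p, ‖iteratedFDeriv ℝ k (fun p : Euc n × Euc n => a p.1 p.2) p‖ ≤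
      C * (1 + ‖p.2‖) ^ ⌈r⌉₊ := fun k => by
    refine exists_norm_iteratedFDeriv_prod_le k hs fun l m => ?_
    obtain ⟨C, hC⟩ := hb l m
    refine ⟨|C|, fun x ξ => (hC x ξ).trans ?_⟩
    rw [← Real.rpow_natCast]
    have h2 : (1 : ℝ) ≤ 1 + ‖ξ‖ := by linarith [norm_nonneg ξ]
    gcongr
    · exact le_abs_self C
    · have := Nat.le_ceil r
      have : (0 : ℝ) ≤ l := Nat.cast_nonneg l
      linarith
  choose C hC using h1
  refine ⟨∑ k ∈ Finset.range (K + 1), |C k|, Finset.sum_nonneg fun _ _ => abs_nonneg _,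
    fun k hk p => (hC k p).trans ?_⟩
  refine mul_le_mul_of_nonneg_right ((le_abs_self _).trans ?_) (by positivity)
  exact Finset.single_le_sum (f := fun k => |C k|) (fun _ _ => abs_nonneg _)
    (Finset.mem_range.2 (by omega))

/-! ### Algebra of amplitudes -/

section AmplitudeAlgebra

variable {V : Type} [NormedAddCommGroup V] [InnerProductSpace ℝ V]

theorem DerivBound.sub {X : Type} [NormedAddCommGroup X] [NormedSpace ℝ X] {K : ℕ}
    {w₁ w₂ : X → ℝ} {f₁ f₂ : X → ℂ} (h₁ : DerivBound K w₁ f₁) (h₂ : DerivBound K w₂ f₂)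
    (hf₁ : ContDiff ℝ (⊤ : ℕ∞) f₁) (hf₂ : ContDiff ℝ (⊤ : ℕ∞) f₂) :
    DerivBound K (fun p => w₁ p + w₂ p) (fun p => f₁ p - f₂ p) := by
  have h := h₁.add (h₂.clm_comp_of_le_one (-ContinuousLinearMap.id ℝ ℂ)
    (by rw [norm_neg]; exact ContinuousLinearMap.norm_id_le) hf₂) hf₁ hf₂.neg
  have h' : DerivBound K (fun p => w₁ p + w₂ p) fun p => f₁ p + -f₂ p := h
  simpa only [← sub_eq_add_neg] using h'

theorem DerivBound.comp_snd {K : ℕ} {w : V → ℝ} {m : V → ℂ} (hb : DerivBound K w m)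
    (hm : ContDiff ℝ (⊤ : ℕ∞) m) :
    DerivBound K (fun p : V × V => w p.2) (fun p : V × V => m p.2) := by
  refine (hb.comp_clm (ContinuousLinearMap.snd ℝ V V) hm).mono le_rfl fun p => ?_
  rw [max_eq_left (ContinuousLinearMap.norm_snd_le ..), one_pow, one_mul]
  rfl

namespace IsAmplitude

variable {d : ℕ} {c c₁ c₂ : V × V → ℂ}

theorem sub (h₁ : IsAmplitude d c₁) (h₂ : IsAmplitude d c₂) :
    IsAmplitude d fun p => c₁ p - c₂ p := by
  refine ⟨h₁.1.sub h₂.1, fun K => ?_⟩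
  obtain ⟨C₁, hC₁, hb₁⟩ := h₁.2 K
  obtain ⟨C₂, hC₂, hb₂⟩ := h₂.2 K
  exact ⟨C₁ + C₂, by positivity, (hb₁.sub hb₂ h₁.1 h₂.1).mono le_rfl fun p => (add_mul _ _ _).ge⟩

theorem succ (h : IsAmplitude d c) : IsAmplitude (d + 1) c := by
  refine ⟨h.1, fun K => ?_⟩
  obtain ⟨C, hC, hb⟩ := h.2 K
  refine ⟨C, hC, hb.mono le_rfl fun p => ?_⟩
  gcongr
  · linarith [norm_nonneg p.2]
  · omega

theorem mul_snd (h : IsAmplitude d c) {m : V → ℂ} (hm : ContDiff ℝ (⊤ : ℕ∞) m)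
    (hb : ∀ K, ∃ C, 0 ≤ C ∧ DerivBound K (fun _ => C) m) :
    IsAmplitude d fun p => c p * m p.2 := by
  refine ⟨h.1.mul (hm.comp contDiff_snd), fun K => ?_⟩
  obtain ⟨C₁, hC₁, hb₁⟩ := h.2 K
  obtain ⟨C₂, hC₂, hb₂⟩ := hb K
  refine ⟨2 ^ K * C₁ * C₂, by positivity,
    (hb₁.mul_complex (hb₂.comp_snd hm) h.1 (hm.comp contDiff_snd)).mono le_rfl fun p => le_of_eq ?_⟩
  ring

theorem exists_norm_le [FiniteDimensional ℝ V] (h : IsAmplitude d c) (η : V) :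
    ∃ C, ∀ x, ‖c (x, η)‖ ≤ C := by
  obtain ⟨C, -, hb⟩ := h.2 0
  exact ⟨C * (1 + ‖η‖) ^ d, fun x => hb.norm_le (x, η)⟩

end IsAmplitude

end AmplitudeAlgebra

/-! ### Low-pass operators: algebra, decay and limit -/

section Blocks

variable {n d : ℕ} {Ψ : ℝ → ℝ} {a : Euc n → Euc n → ℂ}

theorem pseudoDiff_sub {b : Euc n → Euc n → ℂ}
    (ha : IsAmplitude d fun p : Euc n × Euc n => a p.1 p.2)
    (hb : IsAmplitude d fun p : Euc n × Euc n => b p.1 p.2) (u : 𝓢'(Euc n, ℂ)) :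
    pseudoDiff (fun x ξ => a x ξ - b x ξ) u = pseudoDiff a u - pseudoDiff b u := by
  have h := pseudoDiff_add (a := fun x ξ => a x ξ - b x ξ) (b := b) (ha.sub hb) hb
    (by simpa only [sub_add_cancel] using ha) u
  simp only [sub_add_cancel] at h
  rw [h, add_sub_cancel_right]

/-- `Ψ_j(D_x) a(x, η)`. -/
noncomputable def smoothSymbol (Ψ : ℝ → ℝ) (a : Euc n → Euc n → ℂ) (j : ℤ) (x η : Euc n) : ℂ :=
  multiplierConv (fun ζ => lpPsi Ψ j ((2 * Real.pi) • ζ)) (fun y => a y η) x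

theorem smoothSymbol_of_neg {j : ℤ} (hj : j < 0) (x η : Euc n) : smoothSymbol Ψ a j x η = 0 := by
  simp only [smoothSymbol, multiplierConv, lpPsi_of_neg hj, Real.fourierInv_eq]
  simp

theorem smoothSymbol_natCast (hΨ : IsLPCutoff Ψ) (a : Euc n → Euc n → ℂ) (j : ℕ) (x η : Euc n) :
    smoothSymbol Ψ a j x η =
      fstAverage (𝓕⁻ (cutoffMultiplier n hΨ 0)) (2⁻¹ ^ j) (fun p => a p.1 p.2) (x, η) := by
  simp only [smoothSymbol, ← cutoffMultiplier_apply hΨ, cutoffMultiplier_natCast hΨ j]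
  rw [multiplierConv_comp_smul (cutoffMultiplier n hΨ 0) _ (by positivity), fstAverage,
    SchwartzMap.fourierInv_coe]
  rfl

/-- The mass of the kernel is the value of its Fourier transform at the origin, `Ψ(0) = 1`. -/
theorem integral_fourierInv_cutoffMultiplier (hΨ : IsLPCutoff Ψ) :
    ∫ z, 𝓕⁻ (cutoffMultiplier n hΨ 0) z = 1 := by
  have h : 𝓕 (𝓕⁻ (cutoffMultiplier n hΨ 0)) 0 = 1 := by
    rw [FourierTransform.fourier_fourierInv_eq, cutoffMultiplier_apply, smul_zero]
    exact lpPsi_eq_one hΨ 0 (by simp; norm_num)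
  rw [SchwartzMap.fourier_coe, Real.fourier_eq] at h
  simpa using h

theorem isAmplitude_smoothSymbol (hΨ : IsLPCutoff Ψ)
    (ha : IsAmplitude d fun p : Euc n × Euc n => a p.1 p.2) (j : ℤ) :
    IsAmplitude d fun p : Euc n × Euc n => smoothSymbol Ψ a j p.1 p.2 := by
  rcases lt_or_ge j 0 with hj | hj
  · simp only [smoothSymbol_of_neg hj]
    refine ⟨contDiff_const, fun K => ⟨0, le_rfl, fun k _ p => ?_⟩⟩
    simp [iteratedFDeriv_fun_zero]
  · lift j to ℕ using hj
    simp only [smoothSymbol_natCast hΨ]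
    exact ha.fstAverage _ _

theorem exists_derivBound_smoothSymbol (hΨ : IsLPCutoff Ψ)
    (ha : IsAmplitude d fun p : Euc n × Euc n => a p.1 p.2) (K : ℕ) :
    ∃ C, 0 ≤ C ∧ ∀ j : ℤ, DerivBound K (fun p : Euc n × Euc n => C * (1 + ‖p.2‖) ^ d)
      (fun p : Euc n × Euc n => smoothSymbol Ψ a j p.1 p.2) := by
  obtain ⟨C, hC, hb⟩ := ha.2 K
  have h0 : 0 ≤ ∫ z, ‖𝓕⁻ (cutoffMultiplier n hΨ 0) z‖ := integral_nonneg fun _ => norm_nonneg _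
  refine ⟨(∫ z, ‖𝓕⁻ (cutoffMultiplier n hΨ 0) z‖) * C, by positivity, fun j => ?_⟩
  rcases lt_or_ge j 0 with hj | hj
  · simp only [smoothSymbol_of_neg hj]
    intro k _ p
    rw [iteratedFDeriv_fun_zero]
    simp only [Pi.zero_apply, norm_zero]
    positivity
  · lift j to ℕ using hj
    simp only [smoothSymbol_natCast hΨ]
    exact hb.fstAverage hC ha.1

theorem exists_derivBound_smoothSymbol_sub (hΨ : IsLPCutoff Ψ)
    (ha : IsAmplitude d fun p : Euc n × Euc n => a p.1 p.2) (K : ℕ) :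
    ∃ C, 0 ≤ C ∧ ∀ j : ℕ, DerivBound K (fun p : Euc n × Euc n => C * 2⁻¹ ^ j * (1 + ‖p.2‖) ^ d)
      (fun p : Euc n × Euc n => smoothSymbol Ψ a j p.1 p.2 - a p.1 p.2) := by
  obtain ⟨C, hC, hb⟩ := ha.2 (K + 1)
  have h0 : 0 ≤ ∫ z, ‖z‖ * ‖𝓕⁻ (cutoffMultiplier n hΨ 0) z‖ :=
    integral_nonneg fun _ => by positivity
  refine ⟨(∫ z, ‖z‖ * ‖𝓕⁻ (cutoffMultiplier n hΨ 0) z‖) * C, by positivity, fun j => ?_⟩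
  simp only [smoothSymbol_natCast hΨ]
  refine (hb.fstAverage_sub (t := 2⁻¹ ^ j) (integral_fourierInv_cutoffMultiplier hΨ) hC
    ha.1).mono le_rfl fun p => le_of_eq ?_
  rw [abs_of_nonneg (by positivity)]
  ring

theorem symbolBlock_eq (hΨ : IsLPCutoff Ψ)
    (ha : IsAmplitude d fun p : Euc n × Euc n => a p.1 p.2) (j k : ℤ) (x η : Euc n) :
    symbolBlock Ψ a j k x η =
      (smoothSymbol Ψ a j x η - smoothSymbol Ψ a (j - 1) x η) * lpPhiTilde Ψ k η := by
  obtain ⟨C, hC⟩ := ha.exists_norm_le η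
  rw [symbolBlock]
  congr 1
  have h := multiplierConv_sub (cutoffMultiplier n hΨ j) (cutoffMultiplier n hΨ (j - 1))
    (f := fun y => a y η) (ha.1.continuous.comp (by fun_prop : Continuous fun y => (y, η))) hC x
  simp only [smoothSymbol, ← cutoffMultiplier_apply hΨ]
  rw [← h]
  simp only [cutoffMultiplier_apply hΨ]
  rfl

theorem contDiff_lpPhi (hΨ : IsLPCutoff Ψ) (k : ℤ) : ContDiff ℝ (⊤ : ℕ∞) (lpPhi (n := n) Ψ k) :=
  (contDiff_lpPsi hΨ k).sub (contDiff_lpPsi hΨ (k - 1))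

theorem exists_derivBound_const_lpPhi (hΨ : IsLPCutoff Ψ) (k : ℤ) (K : ℕ) :
    ∃ C, 0 ≤ C ∧ DerivBound K (fun _ => C) (lpPhi (n := n) Ψ k) := by
  obtain ⟨C, hC, h⟩ := exists_derivBound_lpPsi n hΨ K
  exact ⟨C + C, by positivity,
    (h k).sub (h (k - 1)) (contDiff_lpPsi hΨ k) (contDiff_lpPsi hΨ (k - 1))⟩

/-- For `k ≥ 1`, `Φ_k = (Ψ_k - 1) - (Ψ_{k-1} - 1)`, both small; the shift in the second term doubles
its bound, whence the `3`. For `k = 0` there is nothing to gain, as `Φ_0 = Ψ_0`. -/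
theorem exists_derivBound_lpPhi (n : ℕ) (hΨ : IsLPCutoff Ψ) (K : ℕ) :
    ∃ C, 0 ≤ C ∧ ∀ k : ℕ, DerivBound K (fun ξ => C * 2⁻¹ ^ k * (1 + ‖ξ‖))
      (lpPhi (n := n) Ψ k) := by
  obtain ⟨C₁, hC₁, h₁⟩ := exists_derivBound_const_lpPhi (n := n) hΨ 0 K
  obtain ⟨C₂, hC₂, h₂⟩ := exists_derivBound_lpPsi_sub_one n hΨ K
  refine ⟨C₁ + 3 * C₂, by positivity, fun k => ?_⟩
  rcases k with _ | k
  · refine h₁.mono le_rfl fun ξ => ?_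
    rw [pow_zero, mul_one]
    nlinarith [norm_nonneg ξ, mul_nonneg hC₁ (norm_nonneg ξ), mul_nonneg hC₂ (norm_nonneg ξ)]
  · have h := (h₂ (k + 1)).sub (h₂ k) ((contDiff_lpPsi hΨ _).sub contDiff_const)
      ((contDiff_lpPsi hΨ _).sub contDiff_const)
    have e : (fun ξ : Euc n => lpPsi Ψ ((k + 1 : ℕ) : ℤ) ξ - 1 - (lpPsi Ψ (k : ℤ) ξ - 1)) =
        lpPhi Ψ ((k + 1 : ℕ) : ℤ) := by
      funext ξ
      rw [lpPhi, show ((k + 1 : ℕ) : ℤ) - 1 = (k : ℤ) by push_cast; ring]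
      ring
    rw [e] at h
    refine h.mono le_rfl fun ξ => ?_
    have h3 : C₂ * 2⁻¹ ^ (k + 1) * (1 + ‖ξ‖) + C₂ * 2⁻¹ ^ k * (1 + ‖ξ‖) =
        3 * C₂ * 2⁻¹ ^ (k + 1) * (1 + ‖ξ‖) := by
      rw [pow_succ]
      ring
    rw [h3]
    gcongr
    linarith

theorem isAmplitude_mul_lpPsi (hΨ : IsLPCutoff Ψ) {c : Euc n × Euc n → ℂ} (hc : IsAmplitude d c)
    (k : ℤ) : IsAmplitude d fun p => c p * lpPsi Ψ k p.2 :=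
  hc.mul_snd (contDiff_lpPsi hΨ k) fun K =>
    (exists_derivBound_lpPsi n hΨ K).imp fun _ h => ⟨h.1, h.2 k⟩

theorem isAmplitude_mul_lpPhi (hΨ : IsLPCutoff Ψ) {c : Euc n × Euc n → ℂ} (hc : IsAmplitude d c)
    (k : ℤ) : IsAmplitude d fun p => c p * lpPhi Ψ k p.2 :=
  hc.mul_snd (contDiff_lpPhi hΨ k) (exists_derivBound_const_lpPhi hΨ k)

theorem isAmplitude_symbolBlock (hΨ : IsLPCutoff Ψ)
    (ha : IsAmplitude d fun p : Euc n × Euc n => a p.1 p.2) (j k : ℤ) :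
    IsAmplitude d fun p : Euc n × Euc n => symbolBlock Ψ a j k p.1 p.2 := by
  have h := (isAmplitude_smoothSymbol hΨ ha j).sub (isAmplitude_smoothSymbol hΨ ha (j - 1))
  have e : ∀ ξ : Euc n, lpPhiTilde Ψ k ξ = lpPsi Ψ (k + 1) ξ - lpPsi Ψ (k - 2) ξ := fun ξ => by
    unfold lpPhiTilde lpPhi
    rw [show k + 1 - 1 = k by ring, show k - 1 - 1 = k - 2 by ring]
    ring
  simp only [symbolBlock_eq hΨ ha, e, mul_sub]
  exact (isAmplitude_mul_lpPsi hΨ h (k + 1)).sub (isAmplitude_mul_lpPsi hΨ h (k - 2))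

/-- `(Ψ_j(D_x) a)(x, D) Φ_k(D) u`. -/
noncomputable def lowPassBlock (Ψ : ℝ → ℝ) (a : Euc n → Euc n → ℂ) (u : 𝓢'(Euc n, ℂ)) (j k : ℤ) :
    𝓢'(Euc n, ℂ) :=
  pseudoDiff (fun x ξ => smoothSymbol Ψ a j x ξ * lpPhi Ψ k ξ) u

/-- `(Ψ_j(D_x) a)(x, D) Ψ_k(D) u`. -/
noncomputable def lowPassTrunc (Ψ : ℝ → ℝ) (a : Euc n → Euc n → ℂ) (u : 𝓢'(Euc n, ℂ)) (j k : ℤ) :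
    𝓢'(Euc n, ℂ) :=
  pseudoDiff (fun x ξ => smoothSymbol Ψ a j x ξ * lpPsi Ψ k ξ) u

/-- The multiplier `Φ_k(D)` is absorbed into the symbol, where `Φ̃_k Φ_k = Φ_k` removes the
auxiliary cut-off. -/
theorem paraTerm_eq (hΨ : IsLPCutoff Ψ) (ha : IsAmplitude d fun p : Euc n × Euc n => a p.1 p.2)
    (u : 𝓢'(Euc n, ℂ)) (j k : ℤ) :
    paraTerm Ψ a u j k = lowPassBlock Ψ a u j k - lowPassBlock Ψ a u (j - 1) k := by
  have hB := isAmplitude_symbolBlock hΨ ha j k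
  have hm : (fun ζ : Euc n => lpPhi Ψ k ((2 * Real.pi) • ζ)).HasTemperateGrowth := by
    have e : (fun ζ : Euc n => lpPhi Ψ k ((2 * Real.pi) • ζ)) =
        ⇑(cutoffMultiplier n hΨ k - cutoffMultiplier n hΨ (k - 1)) := by
      funext ζ
      rw [sub_apply, cutoffMultiplier_apply, cutoffMultiplier_apply]
      rfl
    rw [e]
    exact SchwartzMap.hasTemperateGrowth _
  have h1 := pseudoDiff_fourierMultiplier hB (isAmplitude_mul_lpPhi hΨ hB k) hm
    (fun ξ => by simp only [lpPhi, lpPsi_neg]) u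
  have e : (fun x ξ => symbolBlock Ψ a j k x ξ * lpPhi Ψ k ξ) =
      fun x ξ => smoothSymbol Ψ a j x ξ * lpPhi Ψ k ξ -
        smoothSymbol Ψ a (j - 1) x ξ * lpPhi Ψ k ξ := by
    funext x ξ
    rw [symbolBlock_eq hΨ ha, mul_assoc, lpPhiTilde_mul_lpPhi hΨ, sub_mul]
  rw [e] at h1
  exact h1.trans (pseudoDiff_sub (a := fun x ξ => smoothSymbol Ψ a j x ξ * lpPhi Ψ k ξ)
    (b := fun x ξ => smoothSymbol Ψ a (j - 1) x ξ * lpPhi Ψ k ξ)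
    (isAmplitude_mul_lpPhi hΨ (isAmplitude_smoothSymbol hΨ ha j) k)
    (isAmplitude_mul_lpPhi hΨ (isAmplitude_smoothSymbol hΨ ha (j - 1)) k) u)

theorem lowPassBlock_eq (hΨ : IsLPCutoff Ψ) (ha : IsAmplitude d fun p : Euc n × Euc n => a p.1 p.2)
    (u : 𝓢'(Euc n, ℂ)) (j k : ℤ) :
    lowPassBlock Ψ a u j k = lowPassTrunc Ψ a u j k - lowPassTrunc Ψ a u j (k - 1) := by
  have h := pseudoDiff_sub (a := fun x ξ => smoothSymbol Ψ a j x ξ * lpPsi Ψ k ξ)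
    (b := fun x ξ => smoothSymbol Ψ a j x ξ * lpPsi Ψ (k - 1) ξ)
    (isAmplitude_mul_lpPsi hΨ (isAmplitude_smoothSymbol hΨ ha j) k)
    (isAmplitude_mul_lpPsi hΨ (isAmplitude_smoothSymbol hΨ ha j) (k - 1)) u
  rw [lowPassTrunc, lowPassTrunc, ← h]
  simp only [← mul_sub]
  rfl

theorem pseudoDiff_zero (u : 𝓢'(Euc n, ℂ)) :
    pseudoDiff (fun _ _ => (0 : ℂ)) u = 0 := by
  have h0 : IsAmplitude 0 fun _ : Euc n × Euc n => (0 : ℂ) :=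
    ⟨contDiff_const, fun K => ⟨0, le_rfl, fun k _ p => by simp [iteratedFDeriv_fun_zero]⟩⟩
  have h := pseudoDiff_sub (a := fun _ _ => (0 : ℂ)) (b := fun _ _ => (0 : ℂ)) h0 h0 u
  simpa using h

theorem lowPassTrunc_of_neg_left {j : ℤ} (hj : j < 0) (k : ℤ) (u : 𝓢'(Euc n, ℂ)) :
    lowPassTrunc Ψ a u j k = 0 := by
  simp only [lowPassTrunc, smoothSymbol_of_neg hj, zero_mul]
  exact pseudoDiff_zero u

theorem lowPassTrunc_of_neg_right (j : ℤ) {k : ℤ} (hk : k < 0) (u : 𝓢'(Euc n, ℂ)) :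
    lowPassTrunc Ψ a u j k = 0 := by
  simp only [lowPassTrunc, lpPsi_of_neg hk, mul_zero]
  exact pseudoDiff_zero u

/-- The symbol is considered in order `d + 1`, where `Φ_k` contributes `2^{-k}`, while `Ψ_j(D_x)a`
is bounded in order `d` uniformly in `j`. -/
theorem exists_norm_lowPassBlock_le (hΨ : IsLPCutoff Ψ)
    (ha : IsAmplitude d fun p : Euc n × Euc n => a p.1 p.2) (u : 𝓢'(Euc n, ℂ)) :
    ∃ s : Finset (ℕ × ℕ), ∃ C : ℝ, 0 ≤ C ∧ ∀ (j : ℤ) (k : ℕ) (ψ : 𝓢(Euc n, ℂ)),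
      ‖lowPassBlock Ψ a u j k ψ‖ ≤
        2⁻¹ ^ k * (C * s.sup (schwartzSeminormFamily ℂ (Euc n) ℂ) ψ) := by
  obtain ⟨K, s, C, hC, h⟩ := exists_norm_pseudoDiff_apply_le u (d + 1)
  obtain ⟨C₁, hC₁, h₁⟩ := exists_derivBound_smoothSymbol hΨ ha K
  obtain ⟨C₂, hC₂, h₂⟩ := exists_derivBound_lpPhi n hΨ K
  refine ⟨s, 2 ^ K * C₁ * C₂ * C, by positivity, fun j k ψ => ?_⟩
  have hs := isAmplitude_smoothSymbol hΨ ha j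
  have h3 := (h₁ j).mul_complex ((h₂ k).comp_snd (contDiff_lpPhi hΨ k)) hs.1
    ((contDiff_lpPhi hΨ k).comp contDiff_snd)
  have h4 : DerivBound K (fun p : Euc n × Euc n =>
      2⁻¹ ^ k * (2 ^ K * C₁ * C₂) * (1 + ‖p.2‖) ^ (d + 1))
      (fun p => smoothSymbol Ψ a j p.1 p.2 * lpPhi Ψ k p.2) := by
    refine h3.mono le_rfl fun p => le_of_eq ?_
    rw [pow_succ]
    ring
  have h5 := h (a := fun x ξ => smoothSymbol Ψ a j x ξ * lpPhi Ψ k ξ) (by positivity)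
    (isAmplitude_mul_lpPhi hΨ hs k).succ h4 ψ
  refine h5.trans_eq ?_
  ring

/-- The symbol error splits as `(Ψ_N(D_x)a - a) Ψ_N + a (Ψ_N - 1)`. In order `d + 1` both parts are
`O(2^{-N})`, and the uniform continuity estimate passes this to the operators. -/
theorem tendsto_lowPassTrunc (hΨ : IsLPCutoff Ψ)
    (ha : IsAmplitude d fun p : Euc n × Euc n => a p.1 p.2) (u : 𝓢'(Euc n, ℂ)) :
    Tendsto (fun N : ℕ => lowPassTrunc Ψ a u N N) atTop (𝓝 (pseudoDiff a u)) := by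
  rw [PointwiseConvergenceCLM.tendsto_iff_forall_tendsto]
  intro ψ
  obtain ⟨K, s, C, hC, h⟩ := exists_norm_pseudoDiff_apply_le u (d + 1)
  obtain ⟨C₁, hC₁, h₁⟩ := exists_derivBound_smoothSymbol_sub hΨ ha K
  obtain ⟨C₂, hC₂, h₂⟩ := exists_derivBound_lpPsi n hΨ K
  obtain ⟨C₃, hC₃, h₃⟩ := exists_derivBound_lpPsi_sub_one n hΨ K
  obtain ⟨C₄, hC₄, h₄⟩ := ha.2 K
  rw [tendsto_iff_norm_sub_tendsto_zero]
  have hlim : Tendsto (fun N : ℕ => (2⁻¹ : ℝ) ^ N * ((2 ^ K * C₁ * C₂ + 2 ^ K * C₄ * C₃) *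
      (C * s.sup (schwartzSeminormFamily ℂ (Euc n) ℂ) ψ))) atTop (𝓝 0) := by
    simpa only [zero_mul] using (tendsto_pow_atTop_nhds_zero_of_lt_one (r := (2⁻¹ : ℝ))
      (by norm_num) (by norm_num)).mul_const ((2 ^ K * C₁ * C₂ + 2 ^ K * C₄ * C₃) *
        (C * s.sup (schwartzSeminormFamily ℂ (Euc n) ℂ) ψ))
  refine squeeze_zero (fun _ => norm_nonneg _) (fun N => ?_) hlim
  have hs := isAmplitude_mul_lpPsi hΨ (isAmplitude_smoothSymbol hΨ ha N) N
  have e1 := pseudoDiff_sub (a := fun x ξ => smoothSymbol Ψ a N x ξ * lpPsi Ψ N ξ) hs ha u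
  have e2 : lowPassTrunc Ψ a u N N ψ - pseudoDiff a u ψ =
      pseudoDiff (fun x ξ => smoothSymbol Ψ a N x ξ * lpPsi Ψ N ξ - a x ξ) u ψ := by
    rw [e1]
    rfl
  rw [e2]
  have hd := (isAmplitude_smoothSymbol hΨ ha N).sub ha
  have c2 : ContDiff ℝ (⊤ : ℕ∞) fun p : Euc n × Euc n => lpPsi Ψ N p.2 :=
    (contDiff_lpPsi hΨ N).comp contDiff_snd
  have c3 : ContDiff ℝ (⊤ : ℕ∞) fun ξ : Euc n => lpPsi Ψ N ξ - 1 :=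
    (contDiff_lpPsi hΨ N).sub contDiff_const
  have c3' : ContDiff ℝ (⊤ : ℕ∞) fun p : Euc n × Euc n => lpPsi Ψ N p.2 - 1 :=
    c3.comp contDiff_snd
  have b1 := (h₁ N).mul_complex ((h₂ N).comp_snd (contDiff_lpPsi hΨ N)) hd.1 c2
  have b2 := h₄.mul_complex ((h₃ N).comp_snd c3) ha.1 c3'
  have b3 := b1.add b2 (hd.1.mul c2) (ha.1.mul c3')
  have e3 : (fun p : Euc n × Euc n => (smoothSymbol Ψ a N p.1 p.2 - a p.1 p.2) * lpPsi Ψ N p.2 +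
      a p.1 p.2 * (lpPsi Ψ N p.2 - 1)) =
      fun p => smoothSymbol Ψ a N p.1 p.2 * lpPsi Ψ N p.2 - a p.1 p.2 := by
    funext p
    ring
  rw [e3] at b3
  have b4 : DerivBound K (fun p : Euc n × Euc n =>
      2⁻¹ ^ N * (2 ^ K * C₁ * C₂ + 2 ^ K * C₄ * C₃) * (1 + ‖p.2‖) ^ (d + 1))
      (fun p => smoothSymbol Ψ a N p.1 p.2 * lpPsi Ψ N p.2 - a p.1 p.2) := by
    refine b3.mono le_rfl fun p => ?_
    have h1 : (1 + ‖p.2‖) ^ d ≤ (1 + ‖p.2‖) ^ (d + 1) :=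
      pow_le_pow_right₀ (by linarith [norm_nonneg p.2]) (by omega)
    calc _ = 2⁻¹ ^ N * (2 ^ K * C₁ * C₂) * (1 + ‖p.2‖) ^ d +
          2⁻¹ ^ N * (2 ^ K * C₄ * C₃) * (1 + ‖p.2‖) ^ (d + 1) := by ring
      _ ≤ 2⁻¹ ^ N * (2 ^ K * C₁ * C₂) * (1 + ‖p.2‖) ^ (d + 1) +
          2⁻¹ ^ N * (2 ^ K * C₄ * C₃) * (1 + ‖p.2‖) ^ (d + 1) := by gcongr
      _ = _ := by ring
  exact (h (a := fun x ξ => smoothSymbol Ψ a N x ξ * lpPsi Ψ N ξ - a x ξ) (by positivity)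
    (hs.sub ha).succ b4 ψ).trans_eq (mul_assoc _ _ _)

/-- Series in `𝓢'` with geometrically decaying terms converge. -/
theorem exists_tendsto_sum_temperedDistribution {w : ℕ → 𝓢'(Euc n, ℂ)} {s : Finset (ℕ × ℕ)} {C : ℝ}
    (hC : 0 ≤ C) (h : ∀ k ψ, ‖w k ψ‖ ≤
      2⁻¹ ^ k * (C * s.sup (schwartzSeminormFamily ℂ (Euc n) ℂ) ψ)) :
    ∃ v, Tendsto (fun N => ∑ k ∈ Finset.range N, w k) atTop (𝓝 v) := by
  have hg : Summable fun k : ℕ => (2⁻¹ : ℝ) ^ k :=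
    summable_geometric_of_lt_one (by norm_num) (by norm_num)
  have hs : ∀ ψ, Summable fun k => w k ψ := fun ψ =>
    Summable.of_norm_bounded (hg.mul_right _) fun k => h k ψ
  -- The pointwise sum is continuous because one seminorm controls all the terms.
  let v : 𝓢(Euc n, ℂ) →L[ℂ] ℂ := SchwartzMap.mkCLMtoNormedSpace (σ := RingHom.id ℂ)
    (fun ψ => ∑' k, w k ψ)
    (fun f g => by
      simp only [map_add]
      exact (hs f).tsum_add (hs g))
    (fun a f => by
      simp only [map_smul, smul_eq_mul, RingHom.id_apply]
      exact tsum_mul_left)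
    ⟨s, (∑' k : ℕ, (2⁻¹ : ℝ) ^ k) * C, mul_nonneg (tsum_nonneg fun k => by positivity) hC,
      fun ψ => by
        refine (tsum_of_norm_bounded (hg.hasSum.mul_right _) fun k => h k ψ).trans_eq ?_
        ring⟩
  refine ⟨v.toPointwiseConvergenceCLM _ _ _ _, ?_⟩
  rw [PointwiseConvergenceCLM.tendsto_iff_forall_tendsto]
  intro ψ
  have e : ∀ N, (∑ k ∈ Finset.range N, w k) ψ = ∑ k ∈ Finset.range N, w k ψ := fun N =>
    map_sum (PointwiseConvergenceCLM.evalCLM (RingHom.id ℂ) ℂ ψ) w _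
  simp only [e]
  exact (hs ψ).hasSum.tendsto_sum_nat

end Blocks

/-! ### Telescoping sums -/

section Telescoping

variable {G : Type*} [AddCommGroup G]

theorem sum_range_sub_pred (f : ℤ → G) (m : ℕ) :
    ∑ k ∈ Finset.range m, (f k - f ((k : ℤ) - 1)) = f ((m : ℤ) - 1) - f (-1) := by
  induction m with
  | zero => simp
  | succ m ih =>
    rw [Finset.sum_range_succ, ih]
    push_cast
    rw [add_sub_cancel_right]
    abel

theorem sum_Icc_zero_sub_pred {f : ℤ → G} (hf : f (-1) = 0) {k : ℕ} (hk : 2 ≤ k) :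
    ∑ j ∈ Finset.Icc 0 (k - 2), (f j - f ((j : ℤ) - 1)) = f ((k : ℤ) - 2) := by
  have e : Finset.Icc 0 (k - 2) = Finset.range (k - 1) := by
    ext j
    simp only [Finset.mem_Icc, Finset.mem_range]
    omega
  rw [e, sum_range_sub_pred, hf, sub_zero]
  congr 1
  omega

/-- Lets all three series be summed over the same range, so that they can be compared term by term.
-/
theorem sum_Icc_two_eq_sum_range {f g : ℕ → G} (hfg : ∀ k, 2 ≤ k → f k = g k)
    (hg : ∀ k < 2, g k = 0) (N : ℕ) :
    ∑ k ∈ Finset.Icc 2 N, f k = ∑ k ∈ Finset.range (N + 1), g k := by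
  rw [Finset.sum_congr rfl fun k hk => hfg k (Finset.mem_Icc.1 hk).1]
  refine Finset.sum_subset (fun k hk => ?_) fun k hk hk' => hg k ?_
  · simp only [Finset.mem_Icc, Finset.mem_range] at *
    omega
  · simp only [Finset.mem_Icc, Finset.mem_range] at *
    omega

end Telescoping

/-! ### The three series -/

section Decomposition

variable {n d : ℕ} {Ψ : ℝ → ℝ} {a : Euc n → Euc n → ℂ}

theorem lowPassBlock_of_neg_left (hΨ : IsLPCutoff Ψ)
    (ha : IsAmplitude d fun p : Euc n × Euc n => a p.1 p.2) (u : 𝓢'(Euc n, ℂ)) {j : ℤ} (hj : j < 0)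
    (k : ℤ) : lowPassBlock Ψ a u j k = 0 := by
  rw [lowPassBlock_eq hΨ ha, lowPassTrunc_of_neg_left hj, lowPassTrunc_of_neg_left hj, sub_zero]

theorem lowPassBlock_of_neg_right (hΨ : IsLPCutoff Ψ)
    (ha : IsAmplitude d fun p : Euc n × Euc n => a p.1 p.2) (u : 𝓢'(Euc n, ℂ)) (j : ℤ) {k : ℤ}
    (hk : k < 0) : lowPassBlock Ψ a u j k = 0 := by
  rw [lowPassBlock_eq hΨ ha, lowPassTrunc_of_neg_right _ hk,
    lowPassTrunc_of_neg_right _ (by omega), sub_zero]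

theorem sum_low_high (hΨ : IsLPCutoff Ψ) (ha : IsAmplitude d fun p : Euc n × Euc n => a p.1 p.2)
    (u : 𝓢'(Euc n, ℂ)) (N : ℕ) :
    ∑ k ∈ Finset.Icc 2 N, ∑ j ∈ Finset.Icc 0 (k - 2), paraTerm Ψ a u j k =
      ∑ k ∈ Finset.range (N + 1), lowPassBlock Ψ a u ((k : ℤ) - 2) k := by
  refine sum_Icc_two_eq_sum_range (fun k hk => ?_) (fun k hk => ?_) N
  · simp only [paraTerm_eq hΨ ha]
    exact sum_Icc_zero_sub_pred (f := fun j => lowPassBlock Ψ a u j k)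
      (lowPassBlock_of_neg_left hΨ ha u (by norm_num) _) hk
  · exact lowPassBlock_of_neg_left hΨ ha u (by omega) _

/-- Here the inner sum telescopes in the frequency index `k`, leaving a difference in `j` of
`T_{j,j-2}`; in `sum_low_high` it telescopes in `j`. -/
theorem sum_high_low (hΨ : IsLPCutoff Ψ) (ha : IsAmplitude d fun p : Euc n × Euc n => a p.1 p.2)
    (u : 𝓢'(Euc n, ℂ)) (N : ℕ) :
    ∑ j ∈ Finset.Icc 2 N, ∑ k ∈ Finset.Icc 0 (j - 2), paraTerm Ψ a u j k =
      ∑ j ∈ Finset.range (N + 1), (lowPassTrunc Ψ a u j ((j : ℤ) - 2) -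
        lowPassTrunc Ψ a u ((j : ℤ) - 1) ((j : ℤ) - 2)) := by
  refine sum_Icc_two_eq_sum_range (fun j hj => ?_) (fun j hj => ?_) N
  · rw [← sum_Icc_zero_sub_pred (f := fun k => lowPassTrunc Ψ a u j k -
      lowPassTrunc Ψ a u ((j : ℤ) - 1) k) ?_ hj]
    · refine Finset.sum_congr rfl fun k _ => ?_
      rw [paraTerm_eq hΨ ha, lowPassBlock_eq hΨ ha, lowPassBlock_eq hΨ ha]
      abel
    · simp only [lowPassTrunc_of_neg_right _ (show (-1 : ℤ) < 0 by norm_num), sub_zero]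
  · simp only [lowPassTrunc_of_neg_right _ (show (j : ℤ) - 2 < 0 by omega), sub_zero]

theorem diagonal_terms_eq (hΨ : IsLPCutoff Ψ)
    (ha : IsAmplitude d fun p : Euc n × Euc n => a p.1 p.2) (u : 𝓢'(Euc n, ℂ)) (k : ℕ) :
    paraTerm Ψ a u k k + paraTerm Ψ a u ((k : ℤ) - 1) k + paraTerm Ψ a u k ((k : ℤ) - 1) =
      lowPassBlock Ψ a u k k - lowPassBlock Ψ a u ((k : ℤ) - 2) k +
        (lowPassBlock Ψ a u k ((k : ℤ) - 1) -
          lowPassBlock Ψ a u ((k : ℤ) - 1) ((k : ℤ) - 1)) := by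
  simp only [paraTerm_eq hΨ ha]
  rw [show (k : ℤ) - 1 - 1 = k - 2 by ring]
  abel

/-- At each outer index `k`, the contributions of the three series add up to `T_{k,k} -
T_{k-1,k-1}`, and `T_{-1,-1} = 0`. -/
theorem sum_paraTerm_eq (hΨ : IsLPCutoff Ψ)
    (ha : IsAmplitude d fun p : Euc n × Euc n => a p.1 p.2) (u : 𝓢'(Euc n, ℂ)) (N : ℕ) :
    ∑ j ∈ Finset.Icc 2 N, ∑ k ∈ Finset.Icc 0 (j - 2), paraTerm Ψ a u j k =
      lowPassTrunc Ψ a u N N -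
        ∑ k ∈ Finset.Icc 2 N, ∑ j ∈ Finset.Icc 0 (k - 2), paraTerm Ψ a u j k -
        ∑ k ∈ Finset.range (N + 1), (paraTerm Ψ a u k k + paraTerm Ψ a u ((k : ℤ) - 1) k
          + paraTerm Ψ a u k ((k : ℤ) - 1)) := by
  have h := sum_range_sub_pred (fun k => lowPassTrunc Ψ a u k k) (N + 1)
  rw [lowPassTrunc_of_neg_left (show (-1 : ℤ) < 0 by norm_num), sub_zero,
    show ((N + 1 : ℕ) : ℤ) - 1 = N by push_cast; ring] at h
  rw [← h, sum_high_low hΨ ha, sum_low_high hΨ ha, ← Finset.sum_sub_distrib,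
    ← Finset.sum_sub_distrib]
  refine Finset.sum_congr rfl fun k _ => ?_
  rw [diagonal_terms_eq hΨ ha]
  simp only [lowPassBlock_eq hΨ ha]
  rw [show (k : ℤ) - 1 - 1 = k - 2 by ring]
  abel

theorem exists_tendsto_low_high (hΨ : IsLPCutoff Ψ)
    (ha : IsAmplitude d fun p : Euc n × Euc n => a p.1 p.2) (u : 𝓢'(Euc n, ℂ)) :
    ∃ v : 𝓢'(Euc n, ℂ), Tendsto (fun N : ℕ => ∑ k ∈ Finset.Icc 2 N, ∑ j ∈ Finset.Icc 0 (k - 2),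
      paraTerm Ψ a u j k) atTop (𝓝 v) := by
  obtain ⟨s, C, hC, h⟩ := exists_norm_lowPassBlock_le hΨ ha u
  obtain ⟨v, hv⟩ := exists_tendsto_sum_temperedDistribution
    (w := fun k : ℕ => lowPassBlock Ψ a u ((k : ℤ) - 2) k) hC fun k => h _ k
  simp only [sum_low_high hΨ ha]
  exact ⟨v, hv.comp (tendsto_add_atTop_nat 1)⟩

theorem exists_tendsto_diagonal (hΨ : IsLPCutoff Ψ)
    (ha : IsAmplitude d fun p : Euc n × Euc n => a p.1 p.2) (u : 𝓢'(Euc n, ℂ)) :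
    ∃ v : 𝓢'(Euc n, ℂ), Tendsto (fun N : ℕ => ∑ k ∈ Finset.range (N + 1),
      (paraTerm Ψ a u k k + paraTerm Ψ a u ((k : ℤ) - 1) k
        + paraTerm Ψ a u k ((k : ℤ) - 1))) atTop (𝓝 v) := by
  obtain ⟨s, C, hC, h⟩ := exists_norm_lowPassBlock_le hΨ ha u
  -- The shift to `k - 1` costs a factor `2`; at `k = 0` the block vanishes. The four blocks of a
  -- diagonal term then give `1 + 1 + 2 + 2 = 6`.
  have h' : ∀ (j : ℤ) (k : ℕ) (ψ : 𝓢(Euc n, ℂ)), ‖lowPassBlock Ψ a u j ((k : ℤ) - 1) ψ‖ ≤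
      2 * 2⁻¹ ^ k * (C * s.sup (schwartzSeminormFamily ℂ (Euc n) ℂ) ψ) := by
    intro j k ψ
    have hp : 0 ≤ s.sup (schwartzSeminormFamily ℂ (Euc n) ℂ) ψ := apply_nonneg _ _
    rcases k with _ | k
    · rw [lowPassBlock_of_neg_right hΨ ha u j (by norm_num)]
      have e : (0 : 𝓢'(Euc n, ℂ)) ψ = 0 := rfl
      rw [e, norm_zero]
      positivity
    · rw [show ((k + 1 : ℕ) : ℤ) - 1 = k by push_cast; ring]
      refine (h j k ψ).trans_eq ?_
      rw [pow_succ]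
      ring
  obtain ⟨v, hv⟩ := exists_tendsto_sum_temperedDistribution (w := fun k : ℕ =>
    paraTerm Ψ a u k k + paraTerm Ψ a u ((k : ℤ) - 1) k + paraTerm Ψ a u k ((k : ℤ) - 1))
    (s := s) (C := 6 * C) (by positivity) fun k ψ => by
      rw [diagonal_terms_eq hΨ ha]
      have e : ∀ A B D E : 𝓢'(Euc n, ℂ), (A - B + (D - E)) ψ = A ψ - B ψ + (D ψ - E ψ) :=
        fun _ _ _ _ => rfl
      rw [e]
      refine (norm_add_le_of_le (norm_sub_le_of_le (h k k ψ) (h _ k ψ))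
        (norm_sub_le_of_le (h' k k ψ) (h' _ k ψ))).trans_eq ?_
      ring
  exact ⟨v, hv.comp (tendsto_add_atTop_nat 1)⟩

end Decomposition

theorem mainTheorem9 (n : ℕ) (Ψ : ℝ → ℝ) (hΨ : IsLPCutoff Ψ)
    (a : Euc n → Euc n → ℂ) (ha : IsSymbolOneZero a) (u : 𝓢'(Euc n, ℂ)) :
    IsOpExtension a (pseudoDiff a) ∧
    (∀ j k : ℤ, IsOpExtension (symbolBlock Ψ a j k) (pseudoDiff (symbolBlock Ψ a j k))) ∧
    ∃ v₁ v₂ v₃ : 𝓢'(Euc n, ℂ),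
      Tendsto (fun N : ℕ => ∑ k ∈ Finset.Icc 2 N, ∑ j ∈ Finset.Icc 0 (k - 2),
        paraTerm Ψ a u j k) atTop (𝓝 v₁) ∧
      Tendsto (fun N : ℕ => ∑ k ∈ Finset.Icc 0 N,
        (paraTerm Ψ a u k k + paraTerm Ψ a u ((k : ℤ) - 1) k
          + paraTerm Ψ a u k ((k : ℤ) - 1))) atTop (𝓝 v₂) ∧
      Tendsto (fun N : ℕ => ∑ j ∈ Finset.Icc 2 N, ∑ k ∈ Finset.Icc 0 (j - 2),
        paraTerm Ψ a u j k) atTop (𝓝 v₃) ∧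
      v₁ + v₂ + v₃ = pseudoDiff a u := by
  obtain ⟨d, hA⟩ := ha.exists_isAmplitude
  obtain ⟨v₁, hv₁⟩ := exists_tendsto_low_high hΨ hA u
  obtain ⟨v₂, hv₂⟩ := exists_tendsto_diagonal hΨ hA u
  refine ⟨isOpExtension_pseudoDiff hA,
    fun j k => isOpExtension_pseudoDiff (isAmplitude_symbolBlock hΨ hA j k),
    -- The third limit is the remainder, which makes the final identity immediate; its convergence
    -- comes from `sum_paraTerm_eq`.
    v₁, v₂, pseudoDiff a u - v₁ - v₂, hv₁, ?_, ?_, by abel⟩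
  · have e : ∀ N, Finset.Icc 0 N = Finset.range (N + 1) := fun N => by
      ext k
      simp only [Finset.mem_Icc, Finset.mem_range]
      omega
    simpa only [e] using hv₂
  · simp only [sum_paraTerm_eq hΨ hA]
    exact ((tendsto_lowPassTrunc hΨ hA u).sub hv₁).sub hv₂
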